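/- Let $a,b>0$ and let $\mathbb W=\{\mathbb W(z)\}_{z\in\mathbb R}$ be, on some probability space, either a standard two-sided Brownian motion, or a standard Hermite process $B_{r,H}$ of some order $r\ge 1$ and index $H\in(1/2,1)$, i.e. a process with almost surely continuous paths such that, for a standard two-sided Brownian motion $B$ and every $t\in\mathbb R$, almost surely $$\mathbb W(t)=c_{r,H}\int_{\mathbb R^r}\Big(\int_0^t\prod_{j=1}^r (s-x_j)_+^{-\left(\frac12+\frac{1-H}{r}\right)}\,ds\Big)\,dB(x_1)\cdots dB(x_r)$$ (multiple Wiener–Itô integral), where $c_{r,H}>0$ is the constant for which $\operatorname{Var}\mathbb W(1)=1$. Put $\mathbb G(z)=a\,\mathbb W(z)+b z^2$, $z\in\mathbb R$. For an interval $I$ let $\mathcal T_I(\mathbb G)$ be the greatest convex minorant of $\mathbb G$ on $I$, and let $\mathcal L f$ denote the left derivative of $f$. Define $\mathcal S_{a,b}=\mathcal L\,\mathcal T_{\mathbb R}(\mathbb G)$ and, for $h\in\mathbb R$, $$\mathcal S^h_{a,b}(z)=\begin{cases}\min\{\mathcal L\,\mathcal T_{(-\infty,0)}(\mathbb G)(z),\,h\},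 & z<0,\\ h, & z=0,\\ \max\{\mathcal L\,\mathcal T_{(0,\infty)}(\mathbb G)(z),\,h\}, & z>0.\end{cases}$$ Let $D^h_{a,b}=\{z:\mathcal S_{a,b}(z)\neq\mathcal S^h_{a,b}(z)\}$ and $$L_\infty(h)=\frac1{a^2}\int_{D^h_{a,b}}\big(\mathcal S_{a,b}(z)^2-\mathcal S^h_{a,b}(z)^2\big)dz-\frac{2h}{a^2}\int_{D^h_{a,b}}\big(\mathcal S_{a,b}(z)-\mathcal S^h_{a,b}(z)\big)dz,$$ $$T_\infty(h)=\frac1{a^2}\int_{D^h_{a,b}}\big(\mathcal S_{a,b}(z)-\mathcal S^h_{a,b}(z)\big)^2dz.$$ Then, almost surely, all these integrals converge absolutely for every $h\in\mathbb R$, and: (i) $L_\infty(\mathcal S_{a,b}(0))=T_\infty(\mathcal S_{a,b}(0))=0$; (ii) $h\mapsto L_\infty(h)$ and $h\mapsto T_\infty(h)$ are strictly decreasing on $(-\infty,\mathcal S_{a,b}(0)]$ and strictly increasing on $(\mathcal S_{a,b}(0),\infty)$. -/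

import Mathlib

open MeasureTheory ProbabilityTheory Filter Topology

noncomputable section

namespace MonotoneTrend

/-! ### Greatest convex minorants and their left slopes -/

/-- The greatest convex minorant of `f` on the set `I`: the pointwise supremum of all functions
that are convex on `I` and lie below `f` on `I`. (Meaningful at points of `I`.) -/
def gcm (I : Set ℝ) (f : ℝ → ℝ) (z : ℝ) : ℝ :=
  sSup {y : ℝ | ∃ g : ℝ → ℝ, ConvexOn ℝ I g ∧ (∀ x ∈ I, g x ≤ f x) ∧ y = g z}

/-- The left derivative of `f` at `z`. -/
def leftSlope (f : ℝ → ℝ) (z : ℝ) : ℝ :=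
  derivWithin f (Set.Iio z) z

/-- The unconstrained slope process of a path `G`: left slope of its greatest convex minorant
on the whole line. -/
def slopeGCM (G : ℝ → ℝ) (z : ℝ) : ℝ :=
  leftSlope (gcm Set.univ G) z

/-- The slope process of a path `G` constrained by the level `h` at the origin: the one-sided
slopes of the minorants on `(-∞, 0)` and `(0, ∞)`, truncated above, respectively below, at `h`. -/
def slopeGCMConstrained (G : ℝ → ℝ) (h z : ℝ) : ℝ :=
  if z < 0 then min (leftSlope (gcm (Set.Iio 0) G) z) h
  else if z = 0 then h
  else max (leftSlope (gcm (Set.Ioi 0) G) z) h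

/-- The set on which the two slope processes differ. -/
def diffSet (G : ℝ → ℝ) (h : ℝ) : Set ℝ :=
  {z | slopeGCM G z ≠ slopeGCMConstrained G h z}

/-- The functional `L_∞(h)` of a path `G`. -/
def LInfty (a : ℝ) (G : ℝ → ℝ) (h : ℝ) : ℝ :=
  1 / a ^ 2 * (∫ z in diffSet G h, ((slopeGCM G z) ^ 2 - (slopeGCMConstrained G h z) ^ 2))
    - 2 * h / a ^ 2 * (∫ z in diffSet G h, (slopeGCM G z - slopeGCMConstrained G h z))

/-- The functional `T_∞(h)` of a path `G`. -/
def TInfty (a : ℝ) (G : ℝ → ℝ) (h : ℝ) : ℝ :=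
  1 / a ^ 2 * ∫ z in diffSet G h, (slopeGCM G z - slopeGCMConstrained G h z) ^ 2

/-! ### The driving processes -/

section Processes

variable {Ω : Type*} [MeasurableSpace Ω]

/-- Standard two-sided Brownian motion on `ℝ`, started from `0` at time `0`: the centred Gaussian
process with covariance `(|s| + |t| - |s - t|) / 2` (that is, `min |s| |t|` if `s` and `t` have the
same sign and `0` otherwise) and almost surely continuous paths. -/
structure IsTwoSidedBrownian (B : ℝ → Ω → ℝ) (P : Measure Ω) : Prop where
  isGaussianProcess : IsGaussianProcess B P
  mean_zero : ∀ t, ∫ ω, B t ω ∂P = 0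
  covariance_eq : ∀ s t, cov[B s, B t; P] = (|s| + |t| - |s - t|) / 2
  continuous_paths : ∀ᵐ ω ∂P, Continuous fun t => B t ω

/-- An elementary integrand in `r` variables: a step function on the boxes of a finite grid
`pt 0 < ⋯ < pt N`, vanishing on every box that has two equal sides. -/
structure OffDiagStep (r : ℕ) where
  N : ℕ
  pt : Fin (N + 1) → ℝ
  strictMono_pt : StrictMono pt
  coeff : (Fin r → Fin N) → ℝ
  coeff_eq_zero : ∀ i, ¬ Function.Injective i → coeff i = 0

/-- The step function on `ℝ^r` described by `φ`. -/
def OffDiagStep.toFun {r : ℕ} (φ : OffDiagStep r) (x : Fin r → ℝ) : ℝ :=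
  ∑ i : Fin r → Fin φ.N, φ.coeff i *
    ∏ j, (Set.Ioc (φ.pt (i j).castSucc) (φ.pt (i j).succ)).indicator (fun _ => (1 : ℝ)) (x j)

/-- The multiple Wiener integral of an elementary integrand with respect to `B`. -/
def OffDiagStep.wienerIntegral {r : ℕ} (φ : OffDiagStep r) (B : ℝ → Ω → ℝ) (ω : Ω) : ℝ :=
  ∑ i : Fin r → Fin φ.N, φ.coeff i *
    ∏ j, (B (φ.pt (i j).succ) ω - B (φ.pt (i j).castSucc) ω)

/-- `Y` is (a version of) the `r`-fold multiple Wiener-Itô integral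
`∫_{ℝ^r} f(x₁, …, x_r) dB(x₁) ⋯ dB(x_r)` of `f ∈ L²(ℝ^r)` : it is an `L²(P)` limit of integrals of
elementary integrands that converge to `f` in `L²(ℝ^r)`. -/
def IsMultipleWienerIntegral (B : ℝ → Ω → ℝ) (P : Measure Ω) (r : ℕ) (f : (Fin r → ℝ) → ℝ)
    (Y : Ω → ℝ) : Prop :=
  MemLp f 2 volume ∧ MemLp Y 2 P ∧
    ∃ φ : ℕ → OffDiagStep r,
      Tendsto (fun n => eLpNorm (fun x => f x - (φ n).toFun x) 2 volume) atTop (𝓝 0) ∧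
      Tendsto (fun n => eLpNorm (fun ω => Y ω - (φ n).wienerIntegral B ω) 2 P) atTop (𝓝 0)

/-- The kernel `∫_0^t ∏_j (s - x_j)_+ ^ (-(1/2 + (1 - H)/r)) ds` of the Hermite process of order `r`
with self-similarity index `H`, before normalization. -/
def hermiteKernelCore (r : ℕ) (H t : ℝ) (x : Fin r → ℝ) : ℝ :=
  ∫ s in (0 : ℝ)..t, ∏ j, (if x j < s then (s - x j) ^ (-(1 / 2 + (1 - H) / (r : ℝ))) else 0)

/-- The kernel of the Hermite process, multiplied by the positive constant that gives the process
unit variance at time `1` (for symmetric `f`, the `r`-fold Wiener-Itô integral of `f` has variance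
`r! ∫ f²`). -/
def hermiteKernel (r : ℕ) (H t : ℝ) (x : Fin r → ℝ) : ℝ :=
  (Real.sqrt ((Nat.factorial r : ℝ) * ∫ y : Fin r → ℝ, (hermiteKernelCore r H 1 y) ^ 2))⁻¹
    * hermiteKernelCore r H t x

/-- `Z` is a standard Hermite process on `ℝ` of order `r` and self-similarity index `H` with almost
surely continuous paths (fractional Brownian motion for `r = 1`, the Rosenblatt process for
`r = 2`). -/
def IsHermiteProcess (r : ℕ) (H : ℝ) (Z : ℝ → Ω → ℝ) (P : Measure Ω) : Prop :=
  (∃ B : ℝ → Ω → ℝ, IsTwoSidedBrownian B P ∧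
    ∀ t, IsMultipleWienerIntegral B P r (hermiteKernel r H t) (Z t)) ∧
  ∀ᵐ ω ∂P, Continuous fun t => Z t ω

/-- The path of the limit process `G_{a,b}(z) = a W(z) + b z²`. -/
def driftedPath (a b : ℝ) (W : ℝ → Ω → ℝ) (ω : Ω) (z : ℝ) : ℝ :=
  a * W z ω + b * z ^ 2

end Processes

end MonotoneTrend

end

noncomputable section

namespace MonotoneTrend

/-! ### Left slopes of convex functions -/

/-! The argument is pathwise once three almost sure facts are known: `G` is continuous, it lies
above some `m * z ^ 2 - C` with `m > 0`, and it has no kink at `0`. Let T be the minorant of `G` on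
the whole line and S its left slope. Every supporting line of T touches `G` on both sides of its
base point (`exists_contact_left`, `exists_contact_right`), and on the far side from `0` of a
contact point the one-sided minorant coincides with T. Hence the one-sided slope is at least S on
the left of `0` and at most S on the right, with equality where S(z) < S(0), respectively S(z) >
S(0). Equality on the right needs S(0+) = S(0); a jump there would put a wedge below `G` with vertex
on the path (`exists_pos_slopeGCM_lt`). `RegularSlopes` collects these facts.

They imply that S and the constrained slope agree off a compact interval and agree everywhere for h
= S(0). Completing squares turns L into an integral of (S - h)² - (S^h - h)². The integrands of both
functionals are then monotone in h at every z on each side of S(0), strictly so on an interval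
adjacent to `0`.

Kinks are excluded by stationarity of increments: a continuous path can have kinks of opening δ at
only finitely many of the times 1/(n+1) (`not_frequently_kink`), while the probability of such a
kink is the same at all times, including `0`, hence zero. Growth follows from a Kolmogorov moment
bound by dyadic chaining (`ae_exists_abs_le`). For Brownian motion both inputs come from Gaussian
laws. For Hermite processes, increments are multiple integrals of translated kernels, so
stationarity passes from elementary integrands to the limit, and scaling of the kernel together with
an L² bound for multiple integrals gives second moments of order (t - s)^(2H), where 2H > 1. -/

theorem leftSlope_le_slope {I : Set ℝ} {f : ℝ → ℝ} (hI : IsOpen I) (hf : ConvexOn ℝ I f) {x y : ℝ}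
    (hx : x ∈ I) (hy : y ∈ I) (hxy : x < y) : leftSlope f x * (y - x) ≤ f y - f x := by
  have hxi : x ∈ interior I := by rwa [hI.interior_eq]
  have h1 := hf.leftDeriv_le_rightDeriv_of_mem_interior hxi
  have h2 := hf.rightDeriv_le_slope_of_mem_interior hxi hy hxy
  have h3 : leftSlope f x ≤ slope f x y := h1.trans h2
  rw [slope_def_field, le_div_iff₀ (by linarith)] at h3
  exact h3

theorem slope_le_leftSlope {I : Set ℝ} {f : ℝ → ℝ} (hI : IsOpen I) (hf : ConvexOn ℝ I f) {x y : ℝ}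
    (hx : x ∈ I) (hy : y ∈ I) (hxy : x < y) : f y - f x ≤ leftSlope f y * (y - x) := by
  have hyi : y ∈ interior I := by rwa [hI.interior_eq]
  have h3 := hf.slope_le_leftDeriv_of_mem_interior hx hyi hxy
  rw [slope_def_field, div_le_iff₀ (by linarith)] at h3
  exact h3

theorem leftSlope_support {I : Set ℝ} {f : ℝ → ℝ} (hI : IsOpen I) (hf : ConvexOn ℝ I f) {z : ℝ}
    (hz : z ∈ I) {x : ℝ} (hx : x ∈ I) : f z + leftSlope f z * (x - z) ≤ f x := by
  rcases lt_trichotomy x z with h | h | h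
  · have := slope_le_leftSlope hI hf hx hz h
    linarith
  · simp [h]
  · have := leftSlope_le_slope hI hf hz hx h
    linarith

theorem monotoneOn_leftSlope {I : Set ℝ} {f : ℝ → ℝ} (hI : IsOpen I) (hf : ConvexOn ℝ I f) :
    MonotoneOn (leftSlope f) I := by
  have := hf.monotoneOn_leftDeriv
  rwa [hI.interior_eq] at this

theorem exists_lt_slope_of_lt_leftSlope {I : Set ℝ} {f : ℝ → ℝ} (hI : IsOpen I)
    (hf : ConvexOn ℝ I f) {z α : ℝ} (hz : z ∈ I) (h : α < leftSlope f z) :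
    ∃ x ∈ I, x < z ∧ α * (z - x) < f z - f x := by
  have hzi : z ∈ interior I := by rwa [hI.interior_eq]
  have hd := (hf.hasDerivWithinAt_leftDeriv_of_mem_interior hzi)
  rw [hasDerivWithinAt_iff_tendsto_slope' (by simp)] at hd
  have h1 := hd.eventually (lt_mem_nhds h)
  have h2 : ∀ᶠ x in 𝓝[<] z, x ∈ I := nhdsWithin_le_nhds (hI.mem_nhds hz)
  obtain ⟨x, hx1, hx2, hx3⟩ := (h1.and (h2.and self_mem_nhdsWithin)).exists
  have hx3' : x < z := hx3
  refine ⟨x, hx2, hx3, ?_⟩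
  rw [slope_comm, slope_def_field, lt_div_iff₀ (by linarith)] at hx1
  exact hx1

theorem leftSlope_le_of_forall {I : Set ℝ} {f : ℝ → ℝ} (hI : IsOpen I)
    (hf : ConvexOn ℝ I f) {z α : ℝ} (hz : z ∈ I)
    (h : ∀ x ∈ I, x < z → f z - f x ≤ α * (z - x)) : leftSlope f z ≤ α := by
  by_contra! hlt
  obtain ⟨x, hxI, hxz, hx⟩ := exists_lt_slope_of_lt_leftSlope hI hf hz hlt
  linarith [h x hxI hxz]

theorem leftSlope_congr {f g : ℝ → ℝ} {y z : ℝ} (hyz : y < z)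
    (h : ∀ x, y ≤ x → x ≤ z → f x = g x) : leftSlope f z = leftSlope g z := by
  unfold leftSlope
  refine Filter.EventuallyEq.derivWithin_eq ?_ (h z hyz.le le_rfl)
  filter_upwards [Ioo_mem_nhdsLT hyz] with x hx using h x hx.1.le hx.2.le

theorem leftSlope_eq_of_affine {f : ℝ → ℝ} {y z α β : ℝ} (hyz : y < z)
    (h : ∀ x, y ≤ x → x ≤ z → f x = α * x + β) : leftSlope f z = α := by
  rw [leftSlope_congr (g := fun x => α * x + β) hyz h]
  have : HasDerivAt (fun x : ℝ => α * x + β) α z := by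
    simpa using ((hasDerivAt_id z).const_mul α).add_const β
  exact this.hasDerivWithinAt.derivWithin (uniqueDiffWithinAt_Iio z)

/-- The left slope of a convex function is left-continuous. -/
theorem exists_lt_leftSlope_of_lt {I : Set ℝ} {f : ℝ → ℝ} (hI : IsOpen I)
    (hf : ConvexOn ℝ I f) {z α c : ℝ} (hz : z ∈ I) (hc : c < z) (h : α < leftSlope f z) :
    ∃ y ∈ I, c < y ∧ y < z ∧ α < leftSlope f y := by
  obtain ⟨x, hxI, hxz, hx⟩ := exists_lt_slope_of_lt_leftSlope hI hf hz h
  have hcont : ContinuousAt f z := (hf.continuousOn hI).continuousAt (hI.mem_nhds hz)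
  have h1 : ∀ᶠ y in 𝓝[<] z, α * (y - x) < f y - f x := by
    have hl : ContinuousAt (fun y => α * (y - x)) z := by fun_prop
    have hr : ContinuousAt (fun y => f y - f x) z := hcont.sub continuousAt_const
    exact nhdsWithin_le_nhds (hl.eventually_lt hr hx)
  have h2 : ∀ᶠ x in 𝓝[<] z, x ∈ I := nhdsWithin_le_nhds (hI.mem_nhds hz)
  obtain ⟨y, hy1, hyI, hy2⟩ :=
    (h1.and (h2.and (Ioo_mem_nhdsLT (max_lt hc hxz)))).exists
  have hcy : c < y := (le_max_left _ _).trans_lt hy2.1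
  have hxy : x < y := (le_max_right _ _).trans_lt hy2.1
  refine ⟨y, hyI, hcy, hy2.2, ?_⟩
  have := slope_le_leftSlope hI hf hxI hyI hxy
  have h3 : α * (y - x) < leftSlope f y * (y - x) := hy1.trans_le this
  exact lt_of_mul_lt_mul_right h3 (by linarith)

/-! ### Basic properties of greatest convex minorants -/

theorem le_gcm {I : Set ℝ} {f g : ℝ → ℝ} (hg : ConvexOn ℝ I g) (hgf : ∀ x ∈ I, g x ≤ f x)
    {z : ℝ} (hz : z ∈ I) : g z ≤ gcm I f z := by
  refine le_csSup ⟨f z, ?_⟩ ⟨g, hg, hgf, rfl⟩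
  rintro y ⟨g', -, hg', rfl⟩
  exact hg' z hz

/-- The lower bound `c` supplies a constant minorant, so the set inside `gcm` is nonempty and `sSup`
is a genuine supremum rather than the default `0`. -/
theorem gcm_le_of_forall {I : Set ℝ} {f : ℝ → ℝ} {c : ℝ} (hI : Convex ℝ I)
    (hc : ∀ x ∈ I, c ≤ f x) {z y : ℝ}
    (h : ∀ g : ℝ → ℝ, ConvexOn ℝ I g → (∀ x ∈ I, g x ≤ f x) → g z ≤ y) : gcm I f z ≤ y := by
  refine csSup_le ⟨c, fun _ => c, convexOn_const c hI, hc, rfl⟩ ?_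
  rintro _ ⟨g, hg, hgf, rfl⟩
  exact h g hg hgf

theorem gcm_le {I : Set ℝ} {f : ℝ → ℝ} {c : ℝ} (hI : Convex ℝ I) (hc : ∀ x ∈ I, c ≤ f x) {z : ℝ}
    (hz : z ∈ I) : gcm I f z ≤ f z :=
  gcm_le_of_forall hI hc fun _ _ hg => hg z hz

theorem convexOn_gcm {I : Set ℝ} {f : ℝ → ℝ} {c : ℝ} (hI : Convex ℝ I) (hc : ∀ x ∈ I, c ≤ f x) :
    ConvexOn ℝ I (gcm I f) := by
  refine ⟨hI, fun x hx y hy s t hs ht hst => ?_⟩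
  refine gcm_le_of_forall hI hc fun g hg hgf => ?_
  refine (hg.2 hx hy hs ht hst).trans ?_
  have h1 := le_gcm hg hgf hx
  have h2 := le_gcm hg hgf hy
  simp only [smul_eq_mul]
  gcongr

theorem gcm_mono_set {I J : Set ℝ} {f : ℝ → ℝ} {c : ℝ} (hIJ : I ⊆ J) (hI : Convex ℝ I)
    (hJ : Convex ℝ J) (hc : ∀ x ∈ J, c ≤ f x) {z : ℝ} (hz : z ∈ I) : gcm J f z ≤ gcm I f z :=
  gcm_le_of_forall hJ hc fun _ hg hgf => le_gcm (hg.subset hIJ hI) (fun x hx => hgf x (hIJ hx)) hz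

theorem convexOn_affine (α β : ℝ) : ConvexOn ℝ Set.univ fun x : ℝ => α * x + β :=
  ⟨convex_univ, fun x _ y _ s t _ _ hst => by
    simp only [smul_eq_mul]
    have : β = (s + t) * β := by rw [hst, one_mul]
    nlinarith⟩

theorem affine_le_gcm {G : ℝ → ℝ} {α β : ℝ} (h : ∀ x, α * x + β ≤ G x) (z : ℝ) :
    α * z + β ≤ gcm Set.univ G z :=
  le_gcm (convexOn_affine α β) (fun x _ => h x) (Set.mem_univ z)

/-! ### Contact points of supporting lines -/

theorem exists_forall_ge_quadratic_nonneg {m : ℝ} (hm : 0 < m) (k₁ k₀ : ℝ) :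
    ∃ R, ∀ x ≥ R, k₁ * x + k₀ ≤ m * x ^ 2 := by
  refine ⟨max 1 ((|k₁| + |k₀|) / m), fun x hx => ?_⟩
  have h1 : 1 ≤ x := (le_max_left _ _).trans hx
  have h2 : |k₁| + |k₀| ≤ m * x := by
    have := (le_max_right _ _).trans hx
    rwa [div_le_iff₀ hm, mul_comm] at this
  have h3 := le_abs_self k₁
  have h4 := le_abs_self k₀
  have h5 : (|k₁| + |k₀|) * x ≤ m * x * x := mul_le_mul_of_nonneg_right h2 (by linarith)
  nlinarith [abs_nonneg k₀]

/-- `E` will be the excess of `G` over a supporting line. If it is positive from `z` on, the line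
can be rotated upwards about a point left of `z`: up to a large `R` compactness gives a positive
minimum, and beyond `R` the quadratic growth beats slope 1. -/
theorem exists_tilted_line_le {E : ℝ → ℝ} (hE : Continuous E) {m k₁ k₀ : ℝ} (hm : 0 < m)
    (hquad : ∀ x, m * x ^ 2 ≤ E x + k₁ * x + k₀) (h0 : ∀ x, 0 ≤ E x) {z : ℝ}
    (hz : ∀ x ≥ z, 0 < E x) : ∃ δ > 0, ∃ ε > 0, ∀ x, ε * (x - z + δ) ≤ E x := by
  obtain ⟨y, hyz, hy⟩ : ∃ y < z, ∀ x ∈ Set.Icc y z, 0 < E x := by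
    have h1 : ∀ᶠ x in 𝓝 z, 0 < E x := hE.continuousAt.eventually (lt_mem_nhds (hz z le_rfl))
    obtain ⟨l, hl, hlz⟩ := exists_Ioc_subset_of_mem_nhds h1 ⟨z - 1, by linarith⟩
    refine ⟨(l + z) / 2, by linarith, fun x hx => hlz ⟨?_, hx.2⟩⟩
    linarith [hx.1]
  obtain ⟨R, hR⟩ := exists_forall_ge_quadratic_nonneg hm (k₁ + 1) (k₀ - y)
  have hpos : ∀ x ∈ Set.Icc y (max R z), 0 < E x := by
    intro x hx
    rcases le_total x z with h | h
    · exact hy x ⟨hx.1, h⟩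
    · exact hz x h
  obtain ⟨x₀, hx₀, hmin⟩ := isCompact_Icc.exists_isMinOn
    (Set.nonempty_Icc.2 (hyz.le.trans (le_max_right R z))) hE.continuousOn
  set D := max R z - y with hD
  have hDpos : 0 < D := by
    have := le_max_right R z
    linarith
  refine ⟨z - y, by linarith, min 1 (E x₀ / D), lt_min one_pos (div_pos (hpos _ hx₀) hDpos), ?_⟩
  intro x
  have e : x - z + (z - y) = x - y := by ring
  rw [e]
  rcases lt_or_ge x y with h | h
  · refine le_trans ?_ (h0 x)
    exact mul_nonpos_of_nonneg_of_nonpos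
      (le_min zero_le_one (div_pos (hpos _ hx₀) hDpos).le) (by linarith)
  rcases le_total x (max R z) with h' | h'
  · have h1 : E x₀ ≤ E x := hmin ⟨h, h'⟩
    calc min 1 (E x₀ / D) * (x - y) ≤ E x₀ / D * D :=
          mul_le_mul (min_le_right _ _) (by linarith) (by linarith)
            (div_pos (hpos _ hx₀) hDpos).le
      _ = E x₀ := div_mul_cancel₀ _ hDpos.ne'
      _ ≤ E x := h1
  · have h1 := hR x ((le_max_left _ _).trans h')
    have h2 := hquad x
    calc min 1 (E x₀ / D) * (x - y) ≤ 1 * (x - y) :=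
          mul_le_mul_of_nonneg_right (min_le_left _ _) (by linarith)
      _ ≤ E x := by linarith

section Contact

variable {G : ℝ → ℝ} {m C : ℝ}

theorem neg_le_of_quadratic (hm : 0 < m) (hG : ∀ z, m * z ^ 2 - C ≤ G z) (I : Set ℝ) :
    ∀ x ∈ I, -C ≤ G x := fun x _ => by
  have := hG x
  have : 0 ≤ m * x ^ 2 := by positivity
  linarith [hG x]

/-- Without contact to the right, the rotated line is an affine minorant of `G` that lies strictly
above `gcm Set.univ G` at `z`. Here `α` may be any subgradient, not only the left slope. -/
theorem exists_contact_right (hc : Continuous G) (hm : 0 < m) (hG : ∀ z, m * z ^ 2 - C ≤ G z)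
    {z α : ℝ} (hα : ∀ x, gcm Set.univ G z + α * (x - z) ≤ gcm Set.univ G x) :
    ∃ q ≥ z, G q = gcm Set.univ G z + α * (q - z) := by
  have hle : ∀ x, gcm Set.univ G x ≤ G x := fun x =>
    gcm_le convex_univ (neg_le_of_quadratic hm hG _) (Set.mem_univ x)
  by_contra! hne
  set t := gcm Set.univ G z with ht
  have h0 : ∀ x, 0 ≤ G x - (t + α * (x - z)) := fun x => by linarith [hα x, hle x]
  obtain ⟨δ, hδ, ε, hε, h⟩ := exists_tilted_line_le
    (E := fun x => G x - (t + α * (x - z))) (by fun_prop) hm (k₁ := α) (k₀ := C + t - α * z)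
    (fun x => by linarith [hG x]) h0
    (fun x hx => lt_of_le_of_ne (h0 x) (fun h => hne x hx (by linarith)))
  have := affine_le_gcm (G := G) (α := α + ε) (β := t - α * z + ε * (δ - z))
    (fun x => by linarith [h x]) z
  have h2 : 0 < ε * δ := mul_pos hε hδ
  rw [← ht] at this
  nlinarith

theorem exists_contact_left (hc : Continuous G) (hm : 0 < m) (hG : ∀ z, m * z ^ 2 - C ≤ G z)
    {z α : ℝ} (hα : ∀ x, gcm Set.univ G z + α * (x - z) ≤ gcm Set.univ G x) :
    ∃ p ≤ z, G p = gcm Set.univ G z + α * (p - z) := by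
  have hle : ∀ x, gcm Set.univ G x ≤ G x := fun x =>
    gcm_le convex_univ (neg_le_of_quadratic hm hG _) (Set.mem_univ x)
  by_contra! hne
  set t := gcm Set.univ G z with ht
  have h0 : ∀ x, 0 ≤ G x - (t + α * (x - z)) := fun x => by linarith [hα x, hle x]
  -- Reflection `x ↦ -x` turns the left half-line into the situation of the tilting lemma.
  obtain ⟨δ, hδ, ε, hε, h⟩ := exists_tilted_line_le
    (E := fun x => G (-x) - (t + α * (-x - z))) (by fun_prop) hm (k₁ := -α) (k₀ := C + t - α * z)
    (z := -z) (fun x => by have := hG (-x); rw [neg_sq] at this; linarith) (fun x => h0 _)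
    (fun x hx => lt_of_le_of_ne (h0 _) (fun h => hne (-x) (by linarith) (by linarith)))
  have := affine_le_gcm (G := G) (α := α - ε) (β := t - α * z + ε * (δ + z))
    (fun x => by have := h (-x); rw [neg_neg] at this; linarith) z
  have h2 : 0 < ε * δ := mul_pos hε hδ
  rw [← ht] at this
  nlinarith

/-! ### One-sided minorants agree with the global one beyond a contact point -/

/-- Compare the tangent of a competitor `g` at `x`, of slope `α`, with the tangent of the global
minorant at the contact point `c`, of slope `β`. If `α ≤ β`, the former lies below `G` everywhere:
under `g` on the left of `0`, under the latter tangent on the right. If `β ≤ α`, moving left from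
`c`, where `g c ≤ G c`, already gives the bound at `x`. -/
theorem gcm_Iio_eq_of_contact (hm : 0 < m) (hG : ∀ z, m * z ^ 2 - C ≤ G z)
    {c x : ℝ} (hc0 : c < 0) (hcG : gcm Set.univ G c = G c) (hx : x ≤ c) :
    gcm (Set.Iio 0) G x = gcm Set.univ G x := by
  have hT := convexOn_gcm convex_univ (neg_le_of_quadratic hm hG Set.univ)
  have hle : ∀ x, gcm Set.univ G x ≤ G x := fun x =>
    gcm_le convex_univ (neg_le_of_quadratic hm hG _) (Set.mem_univ x)
  refine le_antisymm ?_ (gcm_mono_set (Set.subset_univ _) (convex_Iio 0) convex_univ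
    (neg_le_of_quadratic hm hG _) (hx.trans_lt hc0))
  refine gcm_le_of_forall (convex_Iio 0) (neg_le_of_quadratic hm hG _) fun g hg hgf => ?_
  have hgc : g c ≤ gcm Set.univ G c := hcG ▸ hgf c hc0
  set α := leftSlope g x
  set β := leftSlope (gcm Set.univ G) c
  have hsg : ∀ y < 0, g x + α * (y - x) ≤ g y := fun y hy =>
    leftSlope_support isOpen_Iio hg (hx.trans_lt hc0) hy
  have hsT : ∀ y, gcm Set.univ G c + β * (y - c) ≤ gcm Set.univ G y := fun y =>
    leftSlope_support isOpen_univ hT (Set.mem_univ c) (Set.mem_univ y)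
  have h1 := hsg c hc0
  rcases le_total α β with hαβ | hαβ
  · have := affine_le_gcm (G := G) (α := α) (β := g x - α * x) (fun y => ?_) x
    · linarith
    · rcases lt_or_ge y 0 with hy | hy
      · linarith [hsg y hy, hgf y hy]
      · have : α * (y - c) ≤ β * (y - c) := mul_le_mul_of_nonneg_right hαβ (by linarith)
        linarith [hsT y, hle y]
  · have : α * (x - c) ≤ β * (x - c) := mul_le_mul_of_nonpos_right hαβ (by linarith)
    linarith [hsT x]

theorem gcm_Ioi_eq_of_contact (hm : 0 < m) (hG : ∀ z, m * z ^ 2 - C ≤ G z)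
    {c x : ℝ} (hc0 : 0 < c) (hcG : gcm Set.univ G c = G c) (hx : c ≤ x) :
    gcm (Set.Ioi 0) G x = gcm Set.univ G x := by
  have hT := convexOn_gcm convex_univ (neg_le_of_quadratic hm hG Set.univ)
  have hle : ∀ x, gcm Set.univ G x ≤ G x := fun x =>
    gcm_le convex_univ (neg_le_of_quadratic hm hG _) (Set.mem_univ x)
  refine le_antisymm ?_ (gcm_mono_set (Set.subset_univ _) (convex_Ioi 0) convex_univ
    (neg_le_of_quadratic hm hG _) (hc0.trans_le hx))
  refine gcm_le_of_forall (convex_Ioi 0) (neg_le_of_quadratic hm hG _) fun g hg hgf => ?_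
  have hgc : g c ≤ gcm Set.univ G c := hcG ▸ hgf c hc0
  set α := leftSlope g x
  set β := leftSlope (gcm Set.univ G) c
  have hsg : ∀ y > 0, g x + α * (y - x) ≤ g y := fun y hy =>
    leftSlope_support isOpen_Ioi hg (hc0.trans_le hx) hy
  have hsT : ∀ y, gcm Set.univ G c + β * (y - c) ≤ gcm Set.univ G y := fun y =>
    leftSlope_support isOpen_univ hT (Set.mem_univ c) (Set.mem_univ y)
  have h1 := hsg c hc0
  rcases le_total β α with hαβ | hαβ
  · have := affine_le_gcm (G := G) (α := α) (β := g x - α * x) (fun y => ?_) x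
    · linarith
    · rcases lt_or_ge 0 y with hy | hy
      · linarith [hsg y hy, hgf y hy]
      · have : α * (y - c) ≤ β * (y - c) := mul_le_mul_of_nonpos_right hαβ (by linarith)
        linarith [hsT y, hle y]
  · have : α * (x - c) ≤ β * (x - c) := mul_le_mul_of_nonneg_right hαβ (by linarith)
    linarith [hsT x]

/-! ### Comparison of the slope processes -/

theorem slopeGCM_support (hm : 0 < m) (hG : ∀ z, m * z ^ 2 - C ≤ G z) (z x : ℝ) :
    gcm Set.univ G z + slopeGCM G z * (x - z) ≤ gcm Set.univ G x :=
  leftSlope_support isOpen_univ (convexOn_gcm convex_univ (neg_le_of_quadratic hm hG Set.univ))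
    (Set.mem_univ z) (Set.mem_univ x)

theorem monotone_slopeGCM (hm : 0 < m) (hG : ∀ z, m * z ^ 2 - C ≤ G z) : Monotone (slopeGCM G) :=
  monotoneOn_univ.1 (monotoneOn_leftSlope isOpen_univ
    (convexOn_gcm convex_univ (neg_le_of_quadratic hm hG Set.univ)))

/-- A convex function that meets a supporting line at two points equals it in between; the contact
at `q` with `G` is also a contact with the minorant. -/
theorem gcm_affine_of_contact_right {z α q x : ℝ} (hm : 0 < m) (hG : ∀ z, m * z ^ 2 - C ≤ G z)
    (hα : ∀ x, gcm Set.univ G z + α * (x - z) ≤ gcm Set.univ G x)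
    (hq : G q = gcm Set.univ G z + α * (q - z)) (hzx : z ≤ x) (hxq : x ≤ q) :
    gcm Set.univ G x = α * x + (gcm Set.univ G z - α * z) := by
  have hT := convexOn_gcm convex_univ (neg_le_of_quadratic hm hG Set.univ)
  have hle : ∀ x, gcm Set.univ G x ≤ G x := fun x =>
    gcm_le convex_univ (neg_le_of_quadratic hm hG _) (Set.mem_univ x)
  refine le_antisymm ?_ (by linarith [hα x])
  have hs := leftSlope_support isOpen_univ hT (Set.mem_univ x) (Set.mem_univ z)
  have hs' := leftSlope_support isOpen_univ hT (Set.mem_univ x) (Set.mem_univ q)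
  have h1 := hle q
  set β := leftSlope (gcm Set.univ G) x
  rcases le_total β α with h | h
  · have : β * (x - z) ≤ α * (x - z) := mul_le_mul_of_nonneg_right h (by linarith)
    linarith
  · have : α * (q - x) ≤ β * (q - x) := mul_le_mul_of_nonneg_right h (by linarith)
    linarith

theorem gcm_affine_of_contact_left {z α p x : ℝ} (hm : 0 < m) (hG : ∀ z, m * z ^ 2 - C ≤ G z)
    (hα : ∀ x, gcm Set.univ G z + α * (x - z) ≤ gcm Set.univ G x)
    (hp : G p = gcm Set.univ G z + α * (p - z)) (hxz : x ≤ z) (hpx : p ≤ x) :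
    gcm Set.univ G x = α * x + (gcm Set.univ G z - α * z) := by
  have hT := convexOn_gcm convex_univ (neg_le_of_quadratic hm hG Set.univ)
  have hle : ∀ x, gcm Set.univ G x ≤ G x := fun x =>
    gcm_le convex_univ (neg_le_of_quadratic hm hG _) (Set.mem_univ x)
  refine le_antisymm ?_ (by linarith [hα x])
  have hs := leftSlope_support isOpen_univ hT (Set.mem_univ x) (Set.mem_univ z)
  have hs' := leftSlope_support isOpen_univ hT (Set.mem_univ x) (Set.mem_univ p)
  have h1 := hle p
  set β := leftSlope (gcm Set.univ G) x
  rcases le_total β α with h | h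
  · have : β * (x - p) ≤ α * (x - p) := mul_le_mul_of_nonneg_right h (by linarith)
    linarith
  · have : α * (z - x) ≤ β * (z - x) := mul_le_mul_of_nonneg_right h (by linarith)
    linarith

/-- The one-sided minorant lies above the global one at `z`, but at the contact point `q` it is at
most `G q`, which is on the supporting line. Its secant from `z` to `q` is therefore no steeper than
that line. When `q = z`, secants to the left of `z` are used instead. -/
theorem leftSlope_gcm_Ioi_le (hc : Continuous G) (hm : 0 < m) (hG : ∀ z, m * z ^ 2 - C ≤ G z)
    {z : ℝ} (hz : 0 < z) : leftSlope (gcm (Set.Ioi 0) G) z ≤ slopeGCM G z := by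
  have hlow := neg_le_of_quadratic hm hG
  have hP := convexOn_gcm (convex_Ioi (0 : ℝ)) (hlow (Set.Ioi 0))
  have hα := slopeGCM_support hm hG z
  obtain ⟨q, hqz, hq⟩ := exists_contact_right hc hm hG hα
  have hge : ∀ x > 0, gcm Set.univ G x ≤ gcm (Set.Ioi 0) G x := fun x hx =>
    gcm_mono_set (Set.subset_univ _) (convex_Ioi 0) convex_univ (hlow _) hx
  have hleq : gcm (Set.Ioi 0) G q ≤ G q := gcm_le (convex_Ioi 0) (hlow _) (hz.trans_le hqz)
  rcases hqz.lt_or_eq with hlt | rfl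
  · have h1 := leftSlope_le_slope isOpen_Ioi hP hz (hz.trans hlt) hlt
    have h2 := hge z hz
    exact le_of_mul_le_mul_right (by linarith) (sub_pos.2 hlt)
  · refine leftSlope_le_of_forall isOpen_Ioi hP hz fun x hx hxz => ?_
    linarith [hα x, hge x hx]

theorem le_leftSlope_gcm_Iio (hc : Continuous G) (hm : 0 < m) (hG : ∀ z, m * z ^ 2 - C ≤ G z)
    {z : ℝ} (hz : z < 0) : slopeGCM G z ≤ leftSlope (gcm (Set.Iio 0) G) z := by
  have hlow := neg_le_of_quadratic hm hG
  have hP := convexOn_gcm (convex_Iio (0 : ℝ)) (hlow (Set.Iio 0))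
  have hα := slopeGCM_support hm hG z
  obtain ⟨p, hpz, hp⟩ := exists_contact_left hc hm hG hα
  have hge : ∀ x < 0, gcm Set.univ G x ≤ gcm (Set.Iio 0) G x := fun x hx =>
    gcm_mono_set (Set.subset_univ _) (convex_Iio 0) convex_univ (hlow _) hx
  have hlep : gcm (Set.Iio 0) G p ≤ G p := gcm_le (convex_Iio 0) (hlow _) (hpz.trans_lt hz)
  rcases hpz.lt_or_eq with hlt | rfl
  · have h1 := slope_le_leftSlope isOpen_Iio hP (hlt.trans hz) hz hlt
    have h2 := hge z hz
    exact le_of_mul_le_mul_right (by linarith) (sub_pos.2 hlt)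
  -- When `z` is itself a contact point there is no secant to use, but the two minorants agree to
  -- the left of it, and left slopes see nothing else.
  · refine (leftSlope_congr (sub_one_lt p) fun x _ hxp => ?_).le
    exact (gcm_Iio_eq_of_contact hm hG hz (by linarith) hxp).symm

/-- The supporting line at `z` touches `G` at some `q ≥ z`. If `q < 0`, the minorants agree to the
left of `q`; if `q ≥ 0`, the global minorant is affine on `[z, 0]`, so the slope at `0` would equal
that at `z`. -/
theorem leftSlope_gcm_Iio_eq (hc : Continuous G) (hm : 0 < m) (hG : ∀ z, m * z ^ 2 - C ≤ G z)
    {z : ℝ} (hz : z < 0) (hS : slopeGCM G z < slopeGCM G 0) :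
    leftSlope (gcm (Set.Iio 0) G) z = slopeGCM G z := by
  have hα := slopeGCM_support hm hG z
  obtain ⟨q, hqz, hq⟩ := exists_contact_right hc hm hG hα
  have hTq : gcm Set.univ G q = G q :=
    le_antisymm (gcm_le convex_univ (neg_le_of_quadratic hm hG _) (Set.mem_univ q)) (hq ▸ hα q)
  rcases lt_or_ge q 0 with hq0 | hq0
  · refine leftSlope_congr (sub_one_lt z) fun x _ hxz => ?_
    exact gcm_Iio_eq_of_contact hm hG hq0 hTq (hxz.trans hqz)
  · have : slopeGCM G 0 = slopeGCM G z := leftSlope_eq_of_affine hz fun x hzx hx0 =>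
      gcm_affine_of_contact_right hm hG hα hq hzx (hx0.trans hq0)
    exact absurd this.symm hS.ne

/-- Agreement is needed on an interval to the left of `z`, so the contact point is sought from some
`y < z` whose slope still exceeds that at `0`, which left-continuity provides. A contact `p ≤ 0`
would make the minorant affine on `[0, y]`, which `hright` forbids. -/
theorem leftSlope_gcm_Ioi_eq (hc : Continuous G) (hm : 0 < m) (hG : ∀ z, m * z ^ 2 - C ≤ G z)
    (hright : ∀ h > slopeGCM G 0, ∃ z > 0, slopeGCM G z < h)
    {z : ℝ} (hz : 0 < z) (hS : slopeGCM G 0 < slopeGCM G z) :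
    leftSlope (gcm (Set.Ioi 0) G) z = slopeGCM G z := by
  have hT := convexOn_gcm convex_univ (neg_le_of_quadratic hm hG Set.univ)
  obtain ⟨y, -, hy0, hyz, hy⟩ := exists_lt_leftSlope_of_lt isOpen_univ hT (Set.mem_univ z) hz hS
  have hα := slopeGCM_support hm hG y
  obtain ⟨p, hpy, hp⟩ := exists_contact_left hc hm hG hα
  have hTp : gcm Set.univ G p = G p :=
    le_antisymm (gcm_le convex_univ (neg_le_of_quadratic hm hG _) (Set.mem_univ p)) (hp ▸ hα p)
  rcases lt_or_ge 0 p with hp0 | hp0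
  · refine leftSlope_congr (hpy.trans_lt hyz) fun x hpx _ => ?_
    exact gcm_Ioi_eq_of_contact hm hG hp0 hTp hpx
  · obtain ⟨x, hx0, hx⟩ := hright _ hy
    rcases le_total y x with hyx | hxy
    · exact absurd (monotone_slopeGCM hm hG hyx) (not_le.2 hx)
    · have : slopeGCM G x = slopeGCM G y := leftSlope_eq_of_affine hx0 fun w h0w hwx =>
        gcm_affine_of_contact_left hm hG hα hp (hwx.trans hxy) (hp0.trans h0w)
      exact absurd this hx.ne

/-! ### Behaviour of the slope process at infinity and at the origin -/

theorem quadratic_le_gcm (hm : 0 < m) (hG : ∀ z, m * z ^ 2 - C ≤ G z) (z : ℝ) :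
    m * z ^ 2 - C ≤ gcm Set.univ G z := by
  refine le_gcm (g := fun z => m * z ^ 2 - C) ?_ (fun x _ => hG x) (Set.mem_univ z)
  have h := ((even_two.convexOn_pow (𝕜 := ℝ)).smul hm.le).add_const (-C)
  simp only [sub_eq_add_neg]
  exact h

theorem exists_forall_ge_lt_slopeGCM (hm : 0 < m) (hG : ∀ z, m * z ^ 2 - C ≤ G z) (h : ℝ) :
    ∃ R > 0, ∀ z ≥ R, h < slopeGCM G z := by
  obtain ⟨R, hR⟩ := exists_forall_ge_quadratic_nonneg hm (h + 1) (C + gcm Set.univ G 0)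
  refine ⟨max R 1, by positivity, fun z hz => ?_⟩
  have hz1 : 1 ≤ z := (le_max_right _ _).trans hz
  have h1 := slopeGCM_support hm hG z 0
  have h2 := hR z ((le_max_left _ _).trans hz)
  have h3 := quadratic_le_gcm hm hG z
  have h4 : h * z < slopeGCM G z * z := by linarith
  exact lt_of_mul_lt_mul_right h4 (by linarith)

theorem exists_forall_le_slopeGCM_lt (hm : 0 < m) (hG : ∀ z, m * z ^ 2 - C ≤ G z) (h : ℝ) :
    ∃ R < 0, ∀ z ≤ R, slopeGCM G z < h := by
  obtain ⟨R, hR⟩ := exists_forall_ge_quadratic_nonneg hm (-h + 1) (C + gcm Set.univ G 0)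
  refine ⟨-max R 1, by simp, fun z hz => ?_⟩
  have hz1 : 1 ≤ -z := (le_max_right R _).trans (by linarith)
  have h1 := slopeGCM_support hm hG z 0
  have h2 := hR (-z) ((le_max_left _ 1).trans (by linarith))
  have h3 := quadratic_le_gcm hm hG z
  rw [neg_sq] at h2
  have h4 : slopeGCM G z * (-z) < h * (-z) := by linarith
  exact lt_of_mul_lt_mul_right h4 (by linarith)

/-- A path has no kink at `0` if it does not lie above a wedge with vertex on the path at `0`. -/
def NoKinkAtZero (G : ℝ → ℝ) : Prop :=
  ∀ s₁ s₂, s₁ < s₂ → ∃ z, G z - G 0 < max (s₁ * z) (s₂ * z)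

/-- If the slope jumped at `0`, the minorant would lie above a wedge there, and a line of
intermediate slope would support it at `0` only. Contact with `G` must then occur at `0`, so `G`
itself lies above the wedge with vertex on the path. -/
theorem exists_pos_slopeGCM_lt (hc : Continuous G) (hm : 0 < m) (hG : ∀ z, m * z ^ 2 - C ≤ G z)
    (hkink : NoKinkAtZero G) {h : ℝ} (hh : slopeGCM G 0 < h) : ∃ z > 0, slopeGCM G z < h := by
  by_contra! hge
  have hT := convexOn_gcm convex_univ (neg_le_of_quadratic hm hG Set.univ)
  have hTc : Continuous (gcm Set.univ G) :=
    continuousOn_univ.1 (hT.continuousOn isOpen_univ)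
  have hle : ∀ x, gcm Set.univ G x ≤ G x := fun x =>
    gcm_le convex_univ (neg_le_of_quadratic hm hG _) (Set.mem_univ x)
  have hl : ∀ x, gcm Set.univ G 0 + slopeGCM G 0 * x ≤ gcm Set.univ G x := fun x => by
    simpa using slopeGCM_support hm hG 0 x
  have hr : ∀ x > 0, gcm Set.univ G 0 + h * x ≤ gcm Set.univ G x := by
    intro x hx
    -- The slope bound holds only at points `y > 0`; continuity of the minorant carries it to the
    -- base point `0`.
    have h1 : ∀ᶠ y in 𝓝[>] (0 : ℝ), gcm Set.univ G y + h * (x - y) ≤ gcm Set.univ G x := by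
      filter_upwards [Ioo_mem_nhdsGT hx] with y hy
      have h2 := slopeGCM_support hm hG y x
      have h3 := mul_le_mul_of_nonneg_right (hge y hy.1) (sub_nonneg.2 hy.2.le)
      linarith
    have h2 : Tendsto (fun y => gcm Set.univ G y + h * (x - y)) (𝓝[>] 0)
        (𝓝 (gcm Set.univ G 0 + h * (x - 0))) :=
      (Continuous.tendsto (by fun_prop) 0).mono_left nhdsWithin_le_nhds
    simpa using le_of_tendsto h2 h1
  set s := (slopeGCM G 0 + h) / 2 with hs
  have hs1 : slopeGCM G 0 < s := by linarith
  have hs2 : s < h := by linarith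
  have hstrict : ∀ x, x ≠ 0 → gcm Set.univ G 0 + s * x < gcm Set.univ G x := by
    intro x hx
    rcases hx.lt_or_gt with hx | hx
    · nlinarith [hl x]
    · nlinarith [hr x hx]
  obtain ⟨q, -, hq⟩ := exists_contact_right (α := s) (z := 0) hc hm hG (fun x => by
    rcases eq_or_ne x 0 with rfl | hx
    · simp
    · simpa using (hstrict x hx).le)
  have hq0 : q = 0 := by
    by_contra hne
    have := hstrict q hne
    have := hle q
    simp only [sub_zero] at hq
    linarith
  subst hq0
  have h0 : G 0 = gcm Set.univ G 0 := by simpa using hq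
  obtain ⟨z, hz⟩ := hkink _ _ hh
  rw [lt_max_iff] at hz
  rcases hz with hz | hz
  · linarith [hl z, hle z]
  · rcases le_or_gt z 0 with hz0 | hz0
    · have : h * z ≤ slopeGCM G 0 * z := mul_le_mul_of_nonpos_right hh.le hz0
      linarith [hl z, hle z]
    · linarith [hr z hz0, hle z]

/-- On this side left-continuity of the left slope suffices, whatever the shape of the path at `0`.
-/
theorem exists_neg_lt_slopeGCM (hm : 0 < m) (hG : ∀ z, m * z ^ 2 - C ≤ G z) {h : ℝ}
    (hh : h < slopeGCM G 0) : ∃ z < 0, h < slopeGCM G z := by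
  have hT := convexOn_gcm convex_univ (neg_le_of_quadratic hm hG Set.univ)
  obtain ⟨y, -, -, hy0, hy⟩ := exists_lt_leftSlope_of_lt isOpen_univ hT (Set.mem_univ 0)
    (sub_one_lt 0) hh
  exact ⟨y, hy0, hy⟩

end Contact

/-! ### Monotonicity of the two functionals for a fixed path -/

/-- The properties of the slope processes of a path that determine the behaviour of the functionals
`LInfty` and `TInfty`. -/
structure RegularSlopes (G : ℝ → ℝ) : Prop where
  monotone : Monotone (slopeGCM G)
  monotoneOn_neg : MonotoneOn (leftSlope (gcm (Set.Iio 0) G)) (Set.Iio 0)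
  monotoneOn_pos : MonotoneOn (leftSlope (gcm (Set.Ioi 0) G)) (Set.Ioi 0)
  le_neg : ∀ z < 0, slopeGCM G z ≤ leftSlope (gcm (Set.Iio 0) G) z
  pos_le : ∀ z > 0, leftSlope (gcm (Set.Ioi 0) G) z ≤ slopeGCM G z
  neg_eq : ∀ z < 0, slopeGCM G z < slopeGCM G 0 → leftSlope (gcm (Set.Iio 0) G) z = slopeGCM G z
  pos_eq : ∀ z > 0, slopeGCM G 0 < slopeGCM G z → leftSlope (gcm (Set.Ioi 0) G) z = slopeGCM G z
  large : ∀ h, ∃ R > 0, ∀ z ≥ R, h < slopeGCM G z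
  small : ∀ h, ∃ R < 0, ∀ z ≤ R, slopeGCM G z < h
  right_zero : ∀ h > slopeGCM G 0, ∃ z > 0, slopeGCM G z < h
  left_zero : ∀ h < slopeGCM G 0, ∃ z < 0, h < slopeGCM G z

theorem regularSlopes_of_noKinkAtZero {G : ℝ → ℝ} {m C : ℝ} (hc : Continuous G) (hm : 0 < m)
    (hG : ∀ z, m * z ^ 2 - C ≤ G z) (hkink : NoKinkAtZero G) : RegularSlopes G where
  monotone := monotone_slopeGCM hm hG
  monotoneOn_neg := monotoneOn_leftSlope isOpen_Iio
    (convexOn_gcm (convex_Iio 0) (neg_le_of_quadratic hm hG _))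
  monotoneOn_pos := monotoneOn_leftSlope isOpen_Ioi
    (convexOn_gcm (convex_Ioi 0) (neg_le_of_quadratic hm hG _))
  le_neg _ hz := le_leftSlope_gcm_Iio hc hm hG hz
  pos_le _ hz := leftSlope_gcm_Ioi_le hc hm hG hz
  neg_eq _ hz h := leftSlope_gcm_Iio_eq hc hm hG hz h
  pos_eq _ hz h := leftSlope_gcm_Ioi_eq hc hm hG
    (fun _ hh => exists_pos_slopeGCM_lt hc hm hG hkink hh) hz h
  large := exists_forall_ge_lt_slopeGCM hm hG
  small := exists_forall_le_slopeGCM_lt hm hG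
  right_zero _ hh := exists_pos_slopeGCM_lt hc hm hG hkink hh
  left_zero _ hh := exists_neg_lt_slopeGCM hm hG hh

namespace RegularSlopes

variable {G : ℝ → ℝ}

theorem constrained_of_neg (h : ℝ) {z : ℝ} (hz : z < 0) :
    slopeGCMConstrained G h z = min (leftSlope (gcm (Set.Iio 0) G) z) h := if_pos hz

theorem constrained_zero (h : ℝ) : slopeGCMConstrained G h 0 = h := by
  simp [slopeGCMConstrained]

theorem constrained_of_pos (h : ℝ) {z : ℝ} (hz : 0 < z) :
    slopeGCMConstrained G h z = max (leftSlope (gcm (Set.Ioi 0) G) z) h := by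
  simp [slopeGCMConstrained, hz.not_gt, hz.ne']

theorem monotone_constrained (hG : RegularSlopes G) (h : ℝ) :
    Monotone (slopeGCMConstrained G h) := by
  intro x y hxy
  rcases lt_trichotomy x 0 with hx | rfl | hx
  · rw [constrained_of_neg h hx]
    rcases lt_trichotomy y 0 with hy | rfl | hy
    · rw [constrained_of_neg h hy]
      exact min_le_min_right _ (hG.monotoneOn_neg hx hy hxy)
    · rw [constrained_zero]
      exact min_le_right _ _
    · rw [constrained_of_pos h hy]
      exact (min_le_right _ _).trans (le_max_right _ _)
  · rw [constrained_zero]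
    rcases hxy.lt_or_eq with hy | rfl
    · rw [constrained_of_pos h hy]
      exact le_max_right _ _
    · rw [constrained_zero]
  · rw [constrained_of_pos h hx, constrained_of_pos h (hx.trans_le hxy)]
    exact max_le_max_right _ (hG.monotoneOn_pos hx (hx.trans_le hxy) hxy)

/-- Where the one-sided slope may differ from the global one, both are at most `slopeGCM G 0 ≤ h`,
and truncation at `h` hides the difference. -/
theorem constrained_of_pos_of_ge (hG : RegularSlopes G) {h z : ℝ} (hh : slopeGCM G 0 ≤ h)
    (hz : 0 < z) :
    slopeGCMConstrained G h z = max (slopeGCM G z) h := by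
  rw [constrained_of_pos h hz]
  rcases le_or_gt (slopeGCM G z) (slopeGCM G 0) with hS | hS
  · rw [max_eq_right (hS.trans hh), max_eq_right ((hG.pos_le z hz).trans (hS.trans hh))]
  · rw [hG.pos_eq z hz hS]

theorem constrained_of_neg_of_le (hG : RegularSlopes G) {h z : ℝ} (hh : h ≤ slopeGCM G 0)
    (hz : z < 0) :
    slopeGCMConstrained G h z = min (slopeGCM G z) h := by
  rw [constrained_of_neg h hz]
  rcases le_or_gt (slopeGCM G 0) (slopeGCM G z) with hS | hS
  · rw [min_eq_right (hh.trans hS), min_eq_right (hh.trans (hS.trans (hG.le_neg z hz)))]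
  · rw [hG.neg_eq z hz hS]

theorem constrained_slopeGCM_zero (hG : RegularSlopes G) :
    slopeGCMConstrained G (slopeGCM G 0) = slopeGCM G := by
  funext z
  rcases lt_trichotomy z 0 with hz | rfl | hz
  · rw [hG.constrained_of_neg_of_le le_rfl hz, min_eq_left (hG.monotone hz.le)]
  · exact constrained_zero _
  · rw [hG.constrained_of_pos_of_ge le_rfl hz, max_eq_left (hG.monotone hz.le)]

/-- Far out, the global slope has passed both `h` and its value at `0`: the truncation is inactive
and the one-sided minorant has the global slope. -/
theorem exists_constrained_eq (hG : RegularSlopes G) (h : ℝ) :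
    ∃ R > 0, ∀ z ∉ Set.Icc (-R) R, slopeGCMConstrained G h z = slopeGCM G z := by
  obtain ⟨R₁, hR₁, h₁⟩ := hG.large (max h (slopeGCM G 0))
  obtain ⟨R₂, hR₂, h₂⟩ := hG.small (min h (slopeGCM G 0))
  refine ⟨max R₁ (-R₂), lt_max_of_lt_left hR₁, fun z hz => ?_⟩
  rw [Set.mem_Icc, not_and_or, not_le, not_le] at hz
  rcases hz with hz | hz
  · have hz' : z ≤ R₂ := by linarith [le_max_right R₁ (-R₂)]
    have h3 := lt_min_iff.1 (h₂ z hz')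
    rw [constrained_of_neg h (hz'.trans_lt hR₂), hG.neg_eq z (hz'.trans_lt hR₂) h3.2,
      min_eq_left h3.1.le]
  · have hz' : R₁ ≤ z := (le_max_left _ _).trans hz.le
    have h3 := max_lt_iff.1 (h₁ z hz')
    rw [constrained_of_pos h (hR₁.trans_le hz'), hG.pos_eq z (hR₁.trans_le hz') h3.2,
      max_eq_left h3.1.le]

/-- The integrand vanishes off `[-R, R]`; inside, both slopes are monotone, so the pair stays in a
compact rectangle on which `F` is bounded. -/
theorem integrable_of_vanishing (hG : RegularSlopes G) {h : ℝ} {F : ℝ → ℝ → ℝ}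
    (hF : Continuous F.uncurry)
    (h0 : ∀ x, F x x = 0) :
    Integrable fun z => F (slopeGCM G z) (slopeGCMConstrained G h z) := by
  obtain ⟨R, hR, hout⟩ := hG.exists_constrained_eq h
  have hmeas : Measurable fun z => F (slopeGCM G z) (slopeGCMConstrained G h z) :=
    hF.measurable.comp (hG.monotone.measurable.prodMk (hG.monotone_constrained h).measurable)
  obtain ⟨M, hM⟩ := ((isCompact_Icc (a := slopeGCM G (-R)) (b := slopeGCM G R)).prod
    (isCompact_Icc (a := slopeGCMConstrained G h (-R))
      (b := slopeGCMConstrained G h R))).exists_bound_of_continuousOn hF.continuousOn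
  have hsupp : Function.support (fun z => F (slopeGCM G z) (slopeGCMConstrained G h z)) ⊆
      Set.Icc (-R) R := by
    intro z hz
    by_contra hne
    exact hz (by simp only [hout z hne, h0])
  rw [← integrableOn_iff_integrable_of_support_subset hsupp]
  refine Measure.integrableOn_of_bounded (M := M) (by simp) hmeas.aestronglyMeasurable ?_
  refine (ae_restrict_iff' measurableSet_Icc).2 (Eventually.of_forall fun z hz => ?_)
  exact hM (_, _) ⟨⟨hG.monotone hz.1, hG.monotone hz.2⟩,
    ⟨hG.monotone_constrained h hz.1, hG.monotone_constrained h hz.2⟩⟩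

theorem setIntegral_diffSet {h : ℝ} {F : ℝ → ℝ → ℝ} (h0 : ∀ x, F x x = 0) :
    ∫ z in diffSet G h, F (slopeGCM G z) (slopeGCMConstrained G h z) =
      ∫ z, F (slopeGCM G z) (slopeGCMConstrained G h z) := by
  refine setIntegral_eq_integral_of_forall_compl_eq_zero fun z hz => ?_
  have : slopeGCM G z = slopeGCMConstrained G h z := by
    by_contra hne
    exact hz hne
  rw [this, h0]

theorem TInfty_eq (a h : ℝ) :
    TInfty a G h = 1 / a ^ 2 * ∫ z, (slopeGCM G z - slopeGCMConstrained G h z) ^ 2 := by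
  rw [TInfty, setIntegral_diffSet (F := fun x y => (x - y) ^ 2) (by simp)]

/-- Uses x² - y² - 2h(x - y) = (x - h)² - (y - h)². In this form the dependence on `h` can be
compared pointwise in `z`. -/
theorem LInfty_eq (hG : RegularSlopes G) (a h : ℝ) :
    LInfty a G h = 1 / a ^ 2 *
      ∫ z, ((slopeGCM G z - h) ^ 2 - (slopeGCMConstrained G h z - h) ^ 2) := by
  rw [LInfty, setIntegral_diffSet (F := fun x y => x ^ 2 - y ^ 2) (by simp),
    setIntegral_diffSet (F := fun x y => x - y) (by simp), mul_comm 2 h, mul_div_assoc,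
    div_eq_mul_one_div 2, ← mul_assoc, mul_comm (h * 2), mul_assoc, ← mul_sub,
    ← integral_const_mul, ← integral_sub]
  · congr 2
    funext z
    ring
  · exact hG.integrable_of_vanishing (F := fun x y => x ^ 2 - y ^ 2) (by fun_prop) (by simp)
  · exact (hG.integrable_of_vanishing (F := fun x y => x - y) (by fun_prop) (by simp)).const_mul _

theorem integrable_T (hG : RegularSlopes G) (h : ℝ) :
    Integrable fun z => (slopeGCM G z - slopeGCMConstrained G h z) ^ 2 :=
  hG.integrable_of_vanishing (F := fun x y => (x - y) ^ 2) (by fun_prop) (by simp)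

theorem integrable_L (hG : RegularSlopes G) (h : ℝ) :
    Integrable fun z => (slopeGCM G z - h) ^ 2 - (slopeGCMConstrained G h z - h) ^ 2 :=
  hG.integrable_of_vanishing (F := fun x y => (x - h) ^ 2 - (y - h) ^ 2) (by fun_prop) (by simp)

/-! ### Strict monotonicity of the integrals in `h` -/

theorem integral_lt_of_le_of_lt_on_Ioo {f g : ℝ → ℝ} (hf : Integrable f) (hg : Integrable g)
    (hfg : ∀ z, f z ≤ g z) {x y : ℝ} (hxy : x < y) (hlt : ∀ z ∈ Set.Ioo x y, f z < g z) :
    ∫ z, f z < ∫ z, g z := by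
  have h := (integral_pos_iff_support_of_nonneg (fun z => sub_nonneg.2 (hfg z)) (hg.sub hf)).2 ?_
  · rw [integral_sub hg hf] at h
    linarith
  · refine lt_of_lt_of_le ?_ (measure_mono (s := Set.Ioo x y) fun z hz => ?_)
    · simpa using hxy
    · exact (sub_pos.2 (hlt z hz)).ne'

/-- For z > 0 the integrand is the square of the positive part of h - S; for z < 0 the constrained
slope is at least S and increases with h. Strictness comes from the interval to the right of `0` on
which S < h₁. -/
theorem strictMonoOn_T (hG : RegularSlopes G) :
    StrictMonoOn (fun h => ∫ z, (slopeGCM G z - slopeGCMConstrained G h z) ^ 2)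
      (Set.Ioi (slopeGCM G 0)) := by
  intro h₁ hh₁ h₂ hh₂ hlt
  obtain ⟨y, hy0, hy⟩ := hG.right_zero h₁ hh₁
  refine integral_lt_of_le_of_lt_on_Ioo (hG.integrable_T h₁) (hG.integrable_T h₂) (fun z => ?_)
    hy0 fun z hz => ?_
  · rcases lt_trichotomy z 0 with hz | rfl | hz
    · rw [constrained_of_neg h₁ hz, constrained_of_neg h₂ hz]
      have h1 := hG.le_neg z hz
      have h2 : slopeGCM G z ≤ h₁ := (hG.monotone hz.le).trans (le_of_lt hh₁)
      have h3 := le_min h1 h2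
      have h4 := min_le_min_left (leftSlope (gcm (Set.Iio 0) G) z) hlt.le
      nlinarith
    · rw [constrained_zero, constrained_zero]
      have : slopeGCM G 0 < h₁ := hh₁
      nlinarith
    · rw [hG.constrained_of_pos_of_ge (le_of_lt hh₁) hz,
        hG.constrained_of_pos_of_ge (le_of_lt hh₂) hz]
      have h3 := le_max_left (slopeGCM G z) h₁
      have h4 := max_le_max_left (slopeGCM G z) hlt.le
      nlinarith
  · rw [hG.constrained_of_pos_of_ge (le_of_lt hh₁) hz.1,
      hG.constrained_of_pos_of_ge (le_of_lt hh₂) hz.1]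
    have h1 : slopeGCM G z < h₁ := (hG.monotone hz.2.le).trans_lt hy
    rw [max_eq_right h1.le, max_eq_right (h1.trans hlt).le]
    nlinarith

theorem strictMonoOn_L (hG : RegularSlopes G) :
    StrictMonoOn (fun h => ∫ z, ((slopeGCM G z - h) ^ 2 - (slopeGCMConstrained G h z - h) ^ 2))
      (Set.Ioi (slopeGCM G 0)) := by
  intro h₁ hh₁ h₂ hh₂ hlt
  obtain ⟨y, hy0, hy⟩ := hG.right_zero h₁ hh₁
  refine integral_lt_of_le_of_lt_on_Ioo (hG.integrable_L h₁) (hG.integrable_L h₂) (fun z => ?_)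
    hy0 fun z hz => ?_
  · rcases lt_trichotomy z 0 with hz | rfl | hz
    · rw [constrained_of_neg h₁ hz, constrained_of_neg h₂ hz]
      have h1 := hG.le_neg z hz
      have h2 : slopeGCM G z ≤ h₁ := (hG.monotone hz.le).trans (le_of_lt hh₁)
      -- With λ ≥ S the one-sided slope, the integrand is (λ - S)(2h - S - λ) when λ ≤ h and (h -
      -- S)² otherwise; it is nondecreasing for h ≥ S.
      rcases min_cases (leftSlope (gcm (Set.Iio 0) G) z) h₁ with ⟨e1, h3⟩ | ⟨e1, h3⟩ <;>
      rcases min_cases (leftSlope (gcm (Set.Iio 0) G) z) h₂ with ⟨e2, h4⟩ | ⟨e2, h4⟩ <;>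
      rw [e1, e2] <;> nlinarith
    · rw [constrained_zero, constrained_zero]
      have : slopeGCM G 0 < h₁ := hh₁
      nlinarith
    · rw [hG.constrained_of_pos_of_ge (le_of_lt hh₁) hz,
        hG.constrained_of_pos_of_ge (le_of_lt hh₂) hz]
      rcases max_cases (slopeGCM G z) h₁ with ⟨e1, h3⟩ | ⟨e1, h3⟩ <;>
      rcases max_cases (slopeGCM G z) h₂ with ⟨e2, h4⟩ | ⟨e2, h4⟩ <;>
      rw [e1, e2] <;> nlinarith
  · rw [hG.constrained_of_pos_of_ge (le_of_lt hh₁) hz.1,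
      hG.constrained_of_pos_of_ge (le_of_lt hh₂) hz.1]
    have h1 : slopeGCM G z < h₁ := (hG.monotone hz.2.le).trans_lt hy
    rw [max_eq_right h1.le, max_eq_right (h1.trans hlt).le]
    nlinarith

theorem strictAntiOn_T (hG : RegularSlopes G) :
    StrictAntiOn (fun h => ∫ z, (slopeGCM G z - slopeGCMConstrained G h z) ^ 2)
      (Set.Iic (slopeGCM G 0)) := by
  intro h₁ hh₁ h₂ hh₂ hlt
  rw [Set.mem_Iic] at hh₁ hh₂
  -- Strictness is obtained on `(y, 0)`, where S > h₁. Only the smaller level must lie strictly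
  -- below the slope at `0`, so the endpoint `h₂ = slopeGCM G 0` is covered.
  obtain ⟨y, hy0, hy⟩ := hG.left_zero h₁ (hlt.trans_le hh₂)
  refine integral_lt_of_le_of_lt_on_Ioo (hG.integrable_T h₂) (hG.integrable_T h₁) (fun z => ?_)
    hy0 fun z hz => ?_
  · rcases lt_trichotomy z 0 with hz | rfl | hz
    · rw [hG.constrained_of_neg_of_le hh₁ hz, hG.constrained_of_neg_of_le hh₂ hz]
      have h3 := min_le_left (slopeGCM G z) h₂
      have h4 := min_le_min_left (slopeGCM G z) hlt.le
      nlinarith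
    · rw [constrained_zero, constrained_zero]
      nlinarith
    · rw [constrained_of_pos h₁ hz, constrained_of_pos h₂ hz]
      have h1 := hG.pos_le z hz
      have h2 : h₂ ≤ slopeGCM G z := hh₂.trans (hG.monotone hz.le)
      have h3 := max_le h1 h2
      have h4 := max_le_max_left (leftSlope (gcm (Set.Ioi 0) G) z) hlt.le
      nlinarith
  · rw [hG.constrained_of_neg_of_le hh₁ hz.2, hG.constrained_of_neg_of_le hh₂ hz.2]
    have h1 : h₁ < slopeGCM G z := hy.trans_le (hG.monotone hz.1.le)
    rw [min_eq_right h1.le]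
    rcases min_cases (slopeGCM G z) h₂ with ⟨e2, h4⟩ | ⟨e2, h4⟩ <;> rw [e2] <;> nlinarith

theorem strictAntiOn_L (hG : RegularSlopes G) :
    StrictAntiOn (fun h => ∫ z, ((slopeGCM G z - h) ^ 2 - (slopeGCMConstrained G h z - h) ^ 2))
      (Set.Iic (slopeGCM G 0)) := by
  intro h₁ hh₁ h₂ hh₂ hlt
  rw [Set.mem_Iic] at hh₁ hh₂
  obtain ⟨y, hy0, hy⟩ := hG.left_zero h₁ (hlt.trans_le hh₂)
  refine integral_lt_of_le_of_lt_on_Ioo (hG.integrable_L h₂) (hG.integrable_L h₁) (fun z => ?_)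
    hy0 fun z hz => ?_
  · rcases lt_trichotomy z 0 with hz | rfl | hz
    · rw [hG.constrained_of_neg_of_le hh₁ hz, hG.constrained_of_neg_of_le hh₂ hz]
      rcases min_cases (slopeGCM G z) h₁ with ⟨e1, h3⟩ | ⟨e1, h3⟩ <;>
      rcases min_cases (slopeGCM G z) h₂ with ⟨e2, h4⟩ | ⟨e2, h4⟩ <;>
      rw [e1, e2] <;> nlinarith
    · rw [constrained_zero, constrained_zero]
      nlinarith
    · rw [constrained_of_pos h₁ hz, constrained_of_pos h₂ hz]
      have h1 := hG.pos_le z hz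
      have h2 : h₂ ≤ slopeGCM G z := hh₂.trans (hG.monotone hz.le)
      rcases max_cases (leftSlope (gcm (Set.Ioi 0) G) z) h₁ with ⟨e1, h3⟩ | ⟨e1, h3⟩ <;>
      rcases max_cases (leftSlope (gcm (Set.Ioi 0) G) z) h₂ with ⟨e2, h4⟩ | ⟨e2, h4⟩ <;>
      rw [e1, e2] <;> nlinarith
  · rw [hG.constrained_of_neg_of_le hh₁ hz.2, hG.constrained_of_neg_of_le hh₂ hz.2]
    have h1 : h₁ < slopeGCM G z := hy.trans_le (hG.monotone hz.1.le)
    rw [min_eq_right h1.le]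
    rcases min_cases (slopeGCM G z) h₂ with ⟨e2, h4⟩ | ⟨e2, h4⟩ <;> rw [e2] <;> nlinarith

end RegularSlopes

/-- The conclusion of the main theorem for a single path. -/
theorem RegularSlopes.conclusion {G : ℝ → ℝ} (hG : RegularSlopes G) {a : ℝ} (ha : 0 < a) :
    (∀ h : ℝ,
      IntegrableOn (fun z => slopeGCM G z ^ 2 - slopeGCMConstrained G h z ^ 2) (diffSet G h) ∧
      IntegrableOn (fun z => slopeGCM G z - slopeGCMConstrained G h z) (diffSet G h) ∧
      IntegrableOn (fun z => (slopeGCM G z - slopeGCMConstrained G h z) ^ 2) (diffSet G h)) ∧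
    (LInfty a G (slopeGCM G 0) = 0 ∧ TInfty a G (slopeGCM G 0) = 0) ∧
    (StrictAntiOn (LInfty a G) (Set.Iic (slopeGCM G 0)) ∧
      StrictMonoOn (LInfty a G) (Set.Ioi (slopeGCM G 0))) ∧
    (StrictAntiOn (TInfty a G) (Set.Iic (slopeGCM G 0)) ∧
      StrictMonoOn (TInfty a G) (Set.Ioi (slopeGCM G 0))) := by
  have hpos : 0 < 1 / a ^ 2 := by positivity
  refine ⟨fun h => ⟨?_, ?_, ?_⟩, ⟨?_, ?_⟩, ⟨?_, ?_⟩, ?_, ?_⟩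
  · exact (hG.integrable_of_vanishing (F := fun x y => x ^ 2 - y ^ 2) (by fun_prop)
      (by simp)).integrableOn
  · exact (hG.integrable_of_vanishing (F := fun x y => x - y) (by fun_prop)
      (by simp)).integrableOn
  · exact (hG.integrable_T h).integrableOn
  · simp [hG.LInfty_eq, hG.constrained_slopeGCM_zero]
  · simp [RegularSlopes.TInfty_eq, hG.constrained_slopeGCM_zero]
  · intro x hx y hy hxy
    rw [hG.LInfty_eq, hG.LInfty_eq]
    exact mul_lt_mul_of_pos_left (hG.strictAntiOn_L hx hy hxy) hpos
  · intro x hx y hy hxy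
    rw [hG.LInfty_eq, hG.LInfty_eq]
    exact mul_lt_mul_of_pos_left (hG.strictMonoOn_L hx hy hxy) hpos
  · intro x hx y hy hxy
    rw [RegularSlopes.TInfty_eq, RegularSlopes.TInfty_eq]
    exact mul_lt_mul_of_pos_left (hG.strictAntiOn_T hx hy hxy) hpos
  · intro x hx y hy hxy
    rw [RegularSlopes.TInfty_eq, RegularSlopes.TInfty_eq]
    exact mul_lt_mul_of_pos_left (hG.strictMonoOn_T hx hy hxy) hpos

/-! ### Kinks of a continuous path -/

/-- Let t' < t be two kink times with lower slopes s' and s. The wedge at t' bounds the secant from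
t' to t below by s' + δ, and the wedge at t bounds it above by s. So the slopes drop by at least δ
from each kink to the next as the times decrease to `0`, yet evaluating each wedge at the fixed
point `-1` bounds the slopes from below. -/
theorem not_frequently_kink {G : ℝ → ℝ} (hc : Continuous G) {δ : ℝ} (hδ : 0 < δ) :
    ¬ ∃ᶠ n : ℕ in atTop, ∃ s, ∀ z,
      max (s * z) ((s + δ) * z) ≤ G (1 / ((n : ℝ) + 1) + z) - G (1 / ((n : ℝ) + 1)) := by
  intro hfreq
  obtain ⟨φ, hφ, hk⟩ := extraction_of_frequently_atTop hfreq
  choose s hs using hk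
  set t : ℕ → ℝ := fun k => 1 / ((φ k : ℝ) + 1) with ht
  have ht0 : ∀ k, 0 < t k := fun k => by positivity
  have ht1 : ∀ k, t k ≤ 1 := fun k => by
    rw [ht]
    simp only
    rw [div_le_one (by positivity)]
    linarith [(Nat.cast_nonneg (φ k) : (0 : ℝ) ≤ φ k)]
  have hanti : ∀ k, t (k + 1) < t k := fun k => by
    have : (φ k : ℝ) < φ (k + 1) := by exact_mod_cast hφ (Nat.lt_succ_self k)
    exact one_div_lt_one_div_of_lt (by positivity) (by linarith)
  have hstep : ∀ k, s (k + 1) + δ ≤ s k := fun k => by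
    have h1 := (le_max_right _ _).trans (hs (k + 1) (t k - t (k + 1)))
    have h2 := (le_max_left _ _).trans (hs k (t (k + 1) - t k))
    have e1 : 1 / ((φ (k + 1) : ℝ) + 1) + (t k - t (k + 1)) = t k := by simp [ht]
    have e2 : 1 / ((φ k : ℝ) + 1) + (t (k + 1) - t k) = t (k + 1) := by simp [ht]
    rw [e1] at h1
    rw [e2] at h2
    have h3 := hanti k
    change _ ≤ G (t k) - G (t (k + 1)) at h1
    change _ ≤ G (t (k + 1)) - G (t k) at h2
    exact le_of_mul_le_mul_right (by linarith) (sub_pos.2 h3)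
  have hbound : ∀ k : ℕ, s k ≤ s 0 - k * δ := by
    intro k
    induction k with
    | zero => simp
    | succ k ih =>
      push_cast
      linarith [hstep k]
  obtain ⟨M, hM⟩ := (isCompact_Icc (a := (0 : ℝ)) (b := 1)).exists_bound_of_continuousOn
    hc.continuousOn
  have hlow : ∀ k, -(M + |G (-1)|) ≤ min (s k) 0 := fun k => by
    have h1 := (le_max_left _ _).trans (hs k (-1 - t k))
    have e1 : 1 / ((φ k : ℝ) + 1) + (-1 - t k) = -1 := by simp [ht]
    rw [e1] at h1
    change _ ≤ G (-1) - G (t k) at h1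
    have h2 := hM (t k) ⟨(ht0 k).le, ht1 k⟩
    rw [Real.norm_eq_abs] at h2
    have h3 := (abs_le.1 h2).1
    have h4 := le_abs_self (G (-1))
    have hM0 : 0 ≤ M := (abs_nonneg _).trans h2
    rcases le_total (s k) 0 with h | h
    · rw [min_eq_left h]
      by_contra! hlt
      nlinarith [ht0 k, ht1 k]
    · rw [min_eq_right h]
      linarith [abs_nonneg (G (-1))]
  obtain ⟨k, hk⟩ := exists_nat_gt ((s 0 + (M + |G (-1)|)) / δ)
  rw [div_lt_iff₀ hδ] at hk
  linarith [hbound k, (hlow k).trans (min_le_left _ _)]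

/-- The set of rational-time paths whose drifted version lies above a wedge of opening `δ`. -/
def wedgeSet (a b δ : ℝ) : Set (ℚ → ℝ) :=
  {x | ∃ q : ℚ, ∀ z : ℚ, max (q * z : ℝ) ((q + δ) * z) ≤ a * x z + b * (z : ℝ) ^ 2}

/-- Slope and time both range over `ℚ`, so only a countable union of countable intersections is
involved. -/
theorem measurableSet_wedgeSet (a b δ : ℝ) : MeasurableSet (wedgeSet a b δ) := by
  unfold wedgeSet
  simp only [Set.ofPred_exists, Set.ofPred_forall]
  refine MeasurableSet.iUnion fun q => MeasurableSet.iInter fun z => ?_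
  exact measurableSet_le measurable_const (by fun_prop)

theorem exists_wedge_of_mem {a b δ t : ℝ} {w : ℝ → ℝ} (hw : Continuous w)
    (h : (fun z : ℚ => w (t + z) - w t) ∈ wedgeSet a b δ) :
    ∃ s, ∀ z, max (s * z) ((s + δ) * z) ≤
      (a * w (t + z) + b * (t + z) ^ 2) - (a * w t + b * t ^ 2) := by
  obtain ⟨q, hq⟩ := h
  have hreal : ∀ z : ℝ, max ((q : ℝ) * z) ((q + δ) * z) ≤ a * (w (t + z) - w t) + b * z ^ 2 := by
    intro z
    have hcl : IsClosed {z : ℝ | max ((q : ℝ) * z) ((q + δ) * z) ≤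
        a * (w (t + z) - w t) + b * z ^ 2} := isClosed_le (by fun_prop) (by fun_prop)
    have := (Rat.isDenseEmbedding_coe_real.dense).closure_eq
    have hsub : Set.range ((↑) : ℚ → ℝ) ⊆ {z : ℝ | max ((q : ℝ) * z) ((q + δ) * z) ≤
        a * (w (t + z) - w t) + b * z ^ 2} := by
      rintro _ ⟨z, rfl⟩
      exact hq z
    have h1 := closure_minimal hsub hcl
    rw [this] at h1
    exact h1 (Set.mem_univ z)
  -- Recentring the drift at `t` gives (t + z)² - t² = 2tz + z², which shifts both slopes by 2bt and
  -- keeps the opening `δ`.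
  refine ⟨q + 2 * b * t, fun z => ?_⟩
  have h1 := (le_max_left _ _).trans (hreal z)
  have h2 := (le_max_right _ _).trans (hreal z)
  refine max_le ?_ ?_ <;> nlinarith

theorem noKinkAtZero_of_forall_notMem {a b : ℝ} {w : ℝ → ℝ}
    (h : ∀ m : ℕ, (fun z : ℚ => w (0 + z) - w 0) ∉ wedgeSet a b (1 / ((m : ℝ) + 1))) :
    NoKinkAtZero fun z => a * w z + b * z ^ 2 := by
  intro s₁ s₂ hs
  by_contra! hge
  obtain ⟨m, hm⟩ := exists_nat_one_div_lt (sub_pos.2 hs)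
  -- This makes the slopes `q` and `q + 1 / (m + 1)` both lie between `s₁` and `s₂`, so the rational
  -- wedge is below the given one.
  obtain ⟨q, hq1, hq2⟩ := exists_rat_btwn (show s₁ < s₂ - 1 / ((m : ℝ) + 1) by linarith)
  have hpos : 0 < 1 / ((m : ℝ) + 1) := by positivity
  refine h m ⟨q, fun z => ?_⟩
  have hz := hge z
  have h1 := (le_max_left _ _).trans hz
  have h2 := (le_max_right _ _).trans hz
  simp only [zero_add]
  rcases le_total (0 : ℝ) z with h0 | h0
  · refine max_le ?_ ?_
    · have : (q : ℝ) * z ≤ s₂ * z := mul_le_mul_of_nonneg_right (by linarith) h0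
      nlinarith
    · have : (q + 1 / ((m : ℝ) + 1)) * z ≤ s₂ * z := mul_le_mul_of_nonneg_right (by linarith) h0
      nlinarith
  · refine max_le ?_ ?_
    · have : (q : ℝ) * z ≤ s₁ * z := mul_le_mul_of_nonpos_right (by linarith) h0
      nlinarith
    · have : (q + 1 / ((m : ℝ) + 1)) * z ≤ s₁ * z := mul_le_mul_of_nonpos_right (by linarith) h0
      nlinarith

/-! ### Transfer of the kink estimate to time `0` by stationarity -/

section RandomPaths

variable {Ω : Type*} [MeasurableSpace Ω]

/-- The finite-dimensional laws of the increments of `W` started at time `s` do not depend on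
`s`. -/
def HasStationaryIncrements (W : ℝ → Ω → ℝ) (P : Measure Ω) : Prop :=
  ∀ (s : ℝ) (I : Finset ℚ), P.map (fun ω (z : I) => W (s + (z : ℚ)) ω - W s ω) =
    P.map (fun ω (z : I) => W (0 + (z : ℚ)) ω - W 0 ω)

/-- The tail unions decrease to the null set of points lying in infinitely many `A n`, while each
has measure at least `p`; finiteness gives continuity from above. -/
theorem measure_eq_zero_of_frequently {P : Measure Ω} [IsFiniteMeasure P] {A : ℕ → Set Ω}
    {p : ENNReal} (hA : ∀ n, NullMeasurableSet (A n) P) (hp : ∀ n, P (A n) = p)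
    (h : ∀ᵐ ω ∂P, ¬ ∃ᶠ n in atTop, ω ∈ A n) : p = 0 := by
  have hlim := tendsto_measure_iInter_atTop (μ := P) (s := fun n => ⋃ k ≥ n, A k)
    (fun n => .iUnion fun k => .iUnion fun _ => hA k)
    (fun m n hmn => Set.biUnion_mono (fun k hk => le_trans hmn hk) fun _ _ => le_rfl)
    ⟨0, measure_ne_top _ _⟩
  have hzero : P (⋂ n, ⋃ k ≥ n, A k) = 0 := by
    refine measure_mono_null (fun ω hω => ?_) (ae_iff.1 h)
    simp only [Set.mem_iInter, Set.mem_iUnion] at hω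
    refine not_not.2 (frequently_atTop.2 fun n => ?_)
    obtain ⟨k, hk, hk'⟩ := hω n
    exact ⟨k, hk, hk'⟩
  rw [hzero] at hlim
  refine le_antisymm (ge_of_tendsto' hlim fun n => ?_) bot_le
  rw [← hp n]
  exact measure_mono (Set.subset_biUnion_of_mem (u := A) (le_refl n))

/-- A continuous process with stationary increments has, almost surely, no kink at the origin. -/
theorem ae_noKinkAtZero {W : ℝ → Ω → ℝ} {P : Measure Ω} [IsProbabilityMeasure P] {a b : ℝ}
    (hmeas : ∀ t, AEMeasurable (W t) P) (hstat : HasStationaryIncrements W P)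
    (hcont : ∀ᵐ ω ∂P, Continuous fun t => W t ω) :
    ∀ᵐ ω ∂P, NoKinkAtZero (driftedPath a b W ω) := by
  have hF : ∀ t, AEMeasurable (fun ω (z : ℚ) => W (t + z) ω - W t ω) P := fun t =>
    aemeasurable_pi_lambda _ fun z => (hmeas _).sub (hmeas _)
  -- Finite-dimensional laws determine the law on `ℚ → ℝ`, so `HasStationaryIncrements` applies to
  -- every measurable event there, in particular to `wedgeSet`.
  have hlaw : ∀ t, P.map (fun ω (z : ℚ) => W (t + z) ω - W t ω) =
      P.map (fun ω (z : ℚ) => W (0 + z) ω - W 0 ω) := fun t =>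
    (map_eq_iff_forall_finset_map_restrict_eq (X := fun (z : ℚ) ω => W (t + z) ω - W t ω)
      (Y := fun (z : ℚ) ω => W (0 + z) ω - W 0 ω) (hF t) (hF 0)).2 (hstat t)
  have hmem : ∀ m : ℕ, ∀ᵐ ω ∂P,
      (fun z : ℚ => W (0 + z) ω - W 0 ω) ∉ wedgeSet a b (1 / ((m : ℝ) + 1)) := by
    intro m
    have hK := measurableSet_wedgeSet a b (1 / ((m : ℝ) + 1))
    have hzero := measure_eq_zero_of_frequently (P := P)
      (A := fun n : ℕ => (fun ω (z : ℚ) =>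
        W (1 / ((n : ℝ) + 1) + z) ω - W (1 / ((n : ℝ) + 1)) ω) ⁻¹'
          wedgeSet a b (1 / ((m : ℝ) + 1)))
      (p := P ((fun ω (z : ℚ) => W (0 + z) ω - W 0 ω) ⁻¹' wedgeSet a b (1 / ((m : ℝ) + 1))))
      (fun n => (hF _).nullMeasurableSet_preimage hK) (fun n => ?_) ?_
    · rw [ae_iff]
      simp only [not_not]
      exact hzero
    · rw [← Measure.map_apply_of_aemeasurable (hF _) hK, hlaw,
        Measure.map_apply_of_aemeasurable (hF _) hK]
    · filter_upwards [hcont] with ω hω hfreq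
      refine not_frequently_kink (G := fun z => a * W z ω + b * z ^ 2) (by fun_prop)
        (show 0 < 1 / ((m : ℝ) + 1) by positivity) (hfreq.mono fun n hn => ?_)
      exact exists_wedge_of_mem hω hn
  filter_upwards [ae_all_iff.2 hmem] with ω hω
  exact noKinkAtZero_of_forall_notMem (w := fun z => W z ω) hω

end RandomPaths

/-! ### Growth of continuous paths -/

/-- Chaining: `x` is the limit of its dyadic floors, consecutive floors are equal or one cell of the
finer grid apart, and the increments are dominated by a geometric series. -/
theorem abs_sub_le_of_dyadic {w : ℝ → ℝ} (hw : Continuous w) {c M r : ℝ} (hr0 : 0 < r) (hr1 : r < 1)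
    (h : ∀ k j : ℕ, j < 2 ^ k →
      |w (c + ((j : ℝ) + 1) / 2 ^ k) - w (c + (j : ℝ) / 2 ^ k)| ≤ M * r ^ k)
    {x : ℝ} (hx : x ∈ Set.Icc c (c + 1)) : |w x - w c| ≤ M / (1 - r) := by
  have hM : 0 ≤ M := by simpa using (abs_nonneg _).trans (h 0 0 (by simp))
  have hr' : 0 < 1 - r := by linarith
  -- At the right endpoint the floor would have index `2 ^ k`, outside the range of `h`; the
  -- level-zero increment covers that point.
  rcases hx.2.lt_or_eq with hlt | rfl
  swap
  · have h1 := h 0 0 (by simp)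
    simp only [Nat.cast_zero, zero_add, pow_zero, div_one, add_zero, mul_one] at h1
    refine h1.trans ?_
    rw [le_div_iff₀ hr']
    nlinarith
  set y := x - c with hy
  have hy0 : 0 ≤ y := by linarith [hx.1]
  have hy1 : y < 1 := by linarith
  set d : ℕ → ℕ := fun k => ⌊y * 2 ^ k⌋₊ with hd
  have hd0 : d 0 = 0 := by
    simp only [hd, pow_zero, mul_one]
    exact Nat.floor_eq_zero.2 hy1
  have hdlt : ∀ k, d k < 2 ^ k := fun k => by
    rw [Nat.floor_lt (by positivity)]
    push_cast
    have : (0 : ℝ) < 2 ^ k := by positivity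
    nlinarith
  have hle : ∀ k, (d k : ℝ) ≤ y * 2 ^ k := fun k => Nat.floor_le (by positivity)
  have hgt : ∀ k, y * 2 ^ k < d k + 1 := fun k => Nat.lt_floor_add_one _
  have hstep : ∀ k, |w (c + d (k + 1) / 2 ^ (k + 1)) - w (c + d k / 2 ^ k)| ≤ M * r ^ (k + 1) := by
    intro k
    have h2k : (0 : ℝ) < 2 ^ k := by positivity
    have hcase : d (k + 1) = 2 * d k ∨ d (k + 1) = 2 * d k + 1 := by
      have h1 : 2 * d k ≤ d (k + 1) := by
        refine Nat.le_floor ?_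
        push_cast
        have := hle k
        rw [pow_succ]
        linarith
      have h2 : d (k + 1) < 2 * d k + 2 := by
        rw [Nat.floor_lt (by positivity)]
        push_cast
        have := hgt k
        rw [pow_succ]
        linarith
      omega
    have e : (d k : ℝ) / 2 ^ k = ((2 * d k : ℕ) : ℝ) / 2 ^ (k + 1) := by
      push_cast
      rw [pow_succ]
      field_simp
    rcases hcase with hc | hc
    · rw [e, hc]
      simp only [sub_self, abs_zero]
      positivity
    · have h1 := h (k + 1) (2 * d k) (by have := hdlt (k + 1); omega)
      rw [e, hc]
      push_cast at h1 ⊢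
      exact h1
  have hsum : ∀ k, |w (c + d k / 2 ^ k) - w c| ≤ M * ∑ i ∈ Finset.range k, r ^ (i + 1) := by
    intro k
    induction k with
    | zero => simp [hd0]
    | succ k ih =>
      rw [Finset.sum_range_succ, mul_add]
      have := abs_sub_le (w (c + d (k + 1) / 2 ^ (k + 1))) (w (c + d k / 2 ^ k)) (w c)
      linarith [hstep k]
  have hgeom : ∀ k, ∑ i ∈ Finset.range k, r ^ (i + 1) ≤ 1 / (1 - r) := by
    intro k
    have h1 : ∑ i ∈ Finset.range k, r ^ (i + 1) ≤ ∑ i ∈ Finset.range k, r ^ i :=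
      Finset.sum_le_sum fun i _ => by
        rw [pow_succ]
        exact mul_le_of_le_one_right (by positivity) hr1.le
    refine h1.trans ?_
    have h2 := Summable.sum_le_tsum (Finset.range k) (fun i _ => by positivity)
      (summable_geometric_of_lt_one hr0.le hr1)
    rwa [tsum_geometric_of_lt_one hr0.le hr1, ← one_div] at h2
  have hlim : Tendsto (fun k => c + (d k : ℝ) / 2 ^ k) atTop (𝓝 x) := by
    have h1 : Tendsto (fun k => (d k : ℝ) / 2 ^ k) atTop (𝓝 y) := by
      have h2 : Tendsto (fun k : ℕ => y - (1 / 2 : ℝ) ^ k) atTop (𝓝 (y - 0)) :=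
        tendsto_const_nhds.sub (tendsto_pow_atTop_nhds_zero_of_lt_one (by norm_num) (by norm_num))
      rw [sub_zero] at h2
      refine tendsto_of_tendsto_of_tendsto_of_le_of_le h2 tendsto_const_nhds (fun k => ?_)
        (fun k => ?_)
      · have h2k : (0 : ℝ) < 2 ^ k := by positivity
        simp only
        rw [le_div_iff₀ h2k, sub_mul, ← mul_pow]
        norm_num
        linarith [hgt k]
      · have h2k : (0 : ℝ) < 2 ^ k := by positivity
        simp only
        rw [div_le_iff₀ h2k]
        exact hle k
    have := h1.const_add c
    rwa [show c + y = x by rw [hy]; ring] at this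
  have hlim' : Tendsto (fun k => |w (c + (d k : ℝ) / 2 ^ k) - w c|) atTop (𝓝 |w x - w c|) :=
    ((hw.tendsto x).comp hlim |>.sub_const _).abs
  refine le_of_tendsto' hlim' fun k => (hsum k).trans ?_
  rw [div_eq_mul_one_div]
  exact mul_le_mul_of_nonneg_left (hgeom k) hM

/-- The oscillation bounds add up to at most ε n², because n + 1 ≤ (n + 1)² - n². The last
incomplete cell costs at most ε(x² + 2), whence the factor `2 * ε`. -/
theorem exists_abs_le_of_oscillation {w : ℝ → ℝ} (hw : Continuous w) {ε : ℝ} (hε : 0 < ε)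
    (h : ∀ᶠ n : ℕ in atTop, ∀ x ∈ Set.Icc (n : ℝ) (n + 1), |w x - w n| ≤ ε * (n + 1)) :
    ∃ C, ∀ x ≥ 0, |w x| ≤ C + 2 * ε * x ^ 2 := by
  obtain ⟨N, hN⟩ := eventually_atTop.1 h
  have hn : ∀ n : ℕ, N ≤ n → |w n - w N| ≤ ε * n ^ 2 := by
    intro n hn
    induction n, hn using Nat.le_induction with
    | base =>
      simp only [sub_self, abs_zero]
      positivity
    | succ n hn ih =>
      have h1 := hN n hn (n + 1) ⟨by linarith, le_rfl⟩
      push_cast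
      have h2 := abs_sub_le (w ((n : ℝ) + 1)) (w n) (w N)
      have h3 : (0 : ℝ) ≤ n := Nat.cast_nonneg n
      nlinarith
  obtain ⟨M, hM⟩ := (isCompact_Icc (a := (0 : ℝ)) (b := N)).exists_bound_of_continuousOn
    hw.continuousOn
  refine ⟨max M (|w N| + 2 * ε), fun x hx => ?_⟩
  have hx2 : 0 ≤ 2 * ε * x ^ 2 := by positivity
  rcases le_total x N with hxN | hxN
  · have := hM x ⟨hx, hxN⟩
    rw [Real.norm_eq_abs] at this
    linarith [le_max_left M (|w N| + 2 * ε)]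
  · set n := ⌊x⌋₊ with hnx
    have h1 : (n : ℝ) ≤ x := Nat.floor_le hx
    have h2 : x < n + 1 := Nat.lt_floor_add_one x
    have h3 : N ≤ n := Nat.le_floor hxN
    have h4 := hN n h3 x ⟨h1, h2.le⟩
    have h5 := hn n h3
    have h6 : |w x| ≤ |w x - w n| + |w n - w N| + |w N| := by
      have e : w x = (w x - w n) + (w n - w N) + w N := by ring
      calc |w x| = |(w x - w n) + (w n - w N) + w N| := by rw [← e]
        _ ≤ _ := abs_add_three _ _ _
    have h7 : (n : ℝ) ^ 2 ≤ x ^ 2 := by gcongr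
    have h8 : ε * (n : ℝ) ^ 2 ≤ ε * x ^ 2 := by gcongr
    have h9 : ε * ((n : ℝ) + 1) ≤ ε * (x ^ 2 + 2) :=
      mul_le_mul_of_nonneg_left (by nlinarith [sq_nonneg (x - 1)]) hε.le
    linarith [le_max_right M (|w N| + 2 * ε)]

/-! ### Kolmogorov chaining in expectation and almost sure growth -/

section RandomPaths

variable {Ω : Type*} [MeasurableSpace Ω]

/-- The weighted sum of `p`-th powers of the dyadic increments of a path over `[c, c + 1]`. -/
def dyadicEnergy (p : ℕ) (r : ENNReal) (w : ℝ → ℝ) (c : ℝ) : ENNReal :=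
  ∑' k : ℕ, ∑ j ∈ Finset.range (2 ^ k),
    ‖w (c + ((j : ℝ) + 1) / 2 ^ k) - w (c + (j : ℝ) / 2 ^ k)‖ₑ ^ p * (r⁻¹ ^ p) ^ k

/-- Each single term is at most the whole energy; taking `p`-th roots gives increments at most `M *
r ^ k`, the input for chaining. -/
theorem abs_sub_le_of_dyadicEnergy_le {p : ℕ} (hp : p ≠ 0) {r M : ℝ} (hr0 : 0 < r) (hr1 : r < 1)
    (hM : 0 ≤ M) {w : ℝ → ℝ} (hw : Continuous w) {c : ℝ}
    (h : dyadicEnergy p (ENNReal.ofReal r) w c ≤ ENNReal.ofReal (M ^ p))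
    {x : ℝ} (hx : x ∈ Set.Icc c (c + 1)) : |w x - w c| ≤ M / (1 - r) := by
  refine abs_sub_le_of_dyadic hw hr0 hr1 (fun k j hj => ?_) hx
  have h1 := (Finset.single_le_sum (f := fun j : ℕ =>
    ‖w (c + ((j : ℝ) + 1) / 2 ^ k) - w (c + (j : ℝ) / 2 ^ k)‖ₑ ^ p *
      ((ENNReal.ofReal r)⁻¹ ^ p) ^ k) (fun _ _ => zero_le)
    (Finset.mem_range.2 hj)).trans ((ENNReal.le_tsum k).trans h)
  rw [← ENNReal.ofReal_inv_of_pos hr0, ← ENNReal.ofReal_pow (by positivity),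
    ← ENNReal.ofReal_pow (by positivity), ← ofReal_norm, ← ENNReal.ofReal_pow (by positivity),
    ← ENNReal.ofReal_mul (by positivity), ENNReal.ofReal_le_ofReal_iff (by positivity),
    Real.norm_eq_abs, ← pow_mul, mul_comm p k, pow_mul, ← mul_pow,
    pow_le_pow_iff_left₀ (by positivity) hM hp, inv_pow, ← div_eq_mul_inv,
    div_le_iff₀ (by positivity)] at h1
  exact h1

/-- The Kolmogorov moment condition for the increments of `W`. -/
def HasMomentBound (W : ℝ → Ω → ℝ) (P : Measure Ω) (p : ℕ) (q C : ℝ) : Prop :=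
  ∀ s t, s ≤ t → ∫⁻ ω, ‖W t ω - W s ω‖ₑ ^ p ∂P ≤ ENNReal.ofReal (C * (t - s) ^ q)

/-- Level `k` has 2^k increments with `p`-th moments at most C 2^(-kq), so its weighted contribution
is at most C (2^(1-q) r^(-p))^k. As q > 1, some `r < 1` close to 1 makes this a convergent geometric
series, uniformly in `c`. -/
theorem exists_lintegral_dyadicEnergy_le {W : ℝ → Ω → ℝ} {P : Measure Ω} {p : ℕ} {q C : ℝ}
    (hmeas : ∀ t, AEMeasurable (W t) P) (hq : 1 < q) (hC : 0 ≤ C)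
    (hmom : HasMomentBound W P p q C) :
    ∃ r : ℝ, 0 < r ∧ r < 1 ∧ ∃ A : ENNReal, A ≠ ⊤ ∧ ∀ c,
      ∫⁻ ω, dyadicEnergy p (ENNReal.ofReal r) (fun t => W t ω) c ∂P ≤ A := by
  obtain ⟨r, hrc, hr0, hr1⟩ : ∃ r : ℝ, (2 : ℝ) ^ (1 - q) < r ^ p ∧ 0 < r ∧ r < 1 := by
    have h1 : (2 : ℝ) ^ (1 - q) < 1 := Real.rpow_lt_one_of_one_lt_of_neg (by norm_num) (by linarith)
    have h2 : ∀ᶠ r : ℝ in 𝓝[<] 1, (2 : ℝ) ^ (1 - q) < r ^ p := by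
      have : ContinuousAt (fun r : ℝ => r ^ p) 1 := by fun_prop
      exact nhdsWithin_le_nhds (this.eventually (lt_mem_nhds (by simpa using h1)))
    obtain ⟨r, h, h'⟩ := (h2.and (Ioo_mem_nhdsLT (zero_lt_one (α := ℝ)))).exists
    exact ⟨r, h, h'.1, h'.2⟩
  set ρ : ℝ := 2 ^ (1 - q) * (r⁻¹ ^ p) with hρ
  have hρ0 : 0 ≤ ρ := by positivity
  have hρ1 : ρ < 1 := by
    rw [hρ, inv_pow, ← div_eq_mul_inv, div_lt_one (by positivity)]
    exact hrc
  refine ⟨r, hr0, hr1, ∑' k : ℕ, ENNReal.ofReal (C * ρ ^ k), ?_, fun c => ?_⟩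
  · exact ((summable_geometric_of_lt_one hρ0 hρ1).mul_left C).tsum_ofReal_ne_top
  · unfold dyadicEnergy
    have hm : ∀ k j : ℕ, AEMeasurable (fun ω => ‖W (c + ((j : ℝ) + 1) / 2 ^ k) ω -
        W (c + (j : ℝ) / 2 ^ k) ω‖ₑ ^ p * ((ENNReal.ofReal r)⁻¹ ^ p) ^ k) P := fun k j =>
      (((hmeas _).sub (hmeas _)).enorm.pow_const _).mul_const _
    rw [lintegral_tsum fun k => Finset.aemeasurable_fun_sum _ fun j _ => hm k j]
    refine ENNReal.tsum_le_tsum fun k => ?_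
    rw [lintegral_finsetSum' _ fun j _ => hm k j]
    have hterm : ∀ j ∈ Finset.range (2 ^ k), ∫⁻ ω, ‖W (c + ((j : ℝ) + 1) / 2 ^ k) ω -
        W (c + (j : ℝ) / 2 ^ k) ω‖ₑ ^ p * ((ENNReal.ofReal r)⁻¹ ^ p) ^ k ∂P ≤
        ENNReal.ofReal (C * (1 / 2 ^ k) ^ q * (r⁻¹ ^ p) ^ k) := by
      intro j _
      have hj : AEMeasurable (fun ω => ‖W (c + ((j : ℝ) + 1) / 2 ^ k) ω -
        W (c + (j : ℝ) / 2 ^ k) ω‖ₑ ^ p) P := ((hmeas _).sub (hmeas _)).enorm.pow_const _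
      rw [lintegral_mul_const'' _ hj,
        ENNReal.ofReal_mul (by positivity), ENNReal.ofReal_pow (by positivity),
        ENNReal.ofReal_pow (by positivity), ENNReal.ofReal_inv_of_pos hr0]
      gcongr
      have h1 := hmom (c + (j : ℝ) / 2 ^ k) (c + ((j : ℝ) + 1) / 2 ^ k) (by gcongr; linarith)
      have e : c + ((j : ℝ) + 1) / 2 ^ k - (c + (j : ℝ) / 2 ^ k) = 1 / 2 ^ k := by ring
      rwa [e] at h1
    refine (Finset.sum_le_sum hterm).trans ?_
    rw [Finset.sum_const, Finset.card_range, nsmul_eq_mul, ← ENNReal.ofReal_natCast,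
      ← ENNReal.ofReal_mul (by positivity)]
    refine le_of_eq (congrArg _ ?_)
    have e : ((2 : ℝ) ^ (1 - q)) ^ k = 2 ^ k * (1 / 2 ^ k) ^ q := by
      rw [Real.rpow_sub two_pos, Real.rpow_one, div_pow, div_eq_mul_one_div, one_div ((2 : ℝ) ^ k),
        Real.inv_rpow (by positivity), one_div, ← Real.rpow_natCast, ← Real.rpow_natCast,
        ← Real.rpow_mul two_pos.le, ← Real.rpow_mul two_pos.le, mul_comm q]
    rw [hρ, mul_pow, e]
    push_cast
    ring

/-- The series of `K n / (n + 1) ^ 2` has finite expectation, so almost surely it converges and its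
terms tend to zero. -/
theorem ae_eventually_le_of_lintegral_le {P : Measure Ω} {K : ℕ → Ω → ENNReal}
    (hK : ∀ n, AEMeasurable (K n) P) {A : ENNReal} (hA : A ≠ ⊤) (hle : ∀ n, ∫⁻ ω, K n ω ∂P ≤ A)
    {η : ℝ} (hη : 0 < η) :
    ∀ᵐ ω ∂P, ∀ᶠ n in atTop, K n ω ≤ ENNReal.ofReal (η * ((n : ℝ) + 1) ^ 2) := by
  have hsum : ∑' n : ℕ, ENNReal.ofReal (1 / ((n : ℝ) + 1) ^ 2) ≠ ⊤ := by
    refine Summable.tsum_ofReal_ne_top ?_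
    have := (summable_nat_add_iff 1).2 (Real.summable_one_div_nat_pow.2 (one_lt_two))
    simpa using this
  have hfin : ∫⁻ ω, ∑' n : ℕ, ENNReal.ofReal (1 / ((n : ℝ) + 1) ^ 2) * K n ω ∂P ≠ ⊤ := by
    rw [lintegral_tsum fun n => (hK n).const_mul _]
    refine ne_top_of_le_ne_top (ENNReal.mul_ne_top hsum hA) ?_
    rw [← ENNReal.tsum_mul_right]
    refine ENNReal.tsum_le_tsum fun n => ?_
    rw [lintegral_const_mul'' _ (hK n)]
    gcongr
    exact hle n
  have hae := ae_lt_top' (AEMeasurable.tsum fun n => (hK n).const_mul _) hfin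
  filter_upwards [hae] with ω hω
  have h0 := ENNReal.tendsto_atTop_zero_of_tsum_ne_top hω.ne
  have h1 := h0.eventually (Iic_mem_nhds (ENNReal.ofReal_pos.2 hη))
  filter_upwards [h1] with n hn
  have hn' : ENNReal.ofReal (1 / ((n : ℝ) + 1) ^ 2) * K n ω ≤ ENNReal.ofReal η := hn
  have hpos : (0 : ℝ) < ((n : ℝ) + 1) ^ 2 := by positivity
  calc K n ω = ENNReal.ofReal (((n : ℝ) + 1) ^ 2) *
        (ENNReal.ofReal (1 / ((n : ℝ) + 1) ^ 2) * K n ω) := by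
        rw [← mul_assoc, ← ENNReal.ofReal_mul hpos.le, mul_one_div_cancel hpos.ne',
          ENNReal.ofReal_one, one_mul]
    _ ≤ ENNReal.ofReal (((n : ℝ) + 1) ^ 2) * ENNReal.ofReal η := by gcongr
    _ = _ := by rw [← ENNReal.ofReal_mul hpos.le, mul_comm]

theorem aemeasurable_dyadicEnergy {W : ℝ → Ω → ℝ} {P : Measure Ω}
    (hmeas : ∀ t, AEMeasurable (W t) P) (p : ℕ) (r : ENNReal) (c : ℝ) :
    AEMeasurable (fun ω => dyadicEnergy p r (fun t => W t ω) c) P :=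
  AEMeasurable.tsum fun _ => Finset.aemeasurable_fun_sum _ fun _ _ =>
    (((hmeas _).sub (hmeas _)).enorm.pow_const _).mul_const _

/-- A process satisfying the Kolmogorov condition with exponent `p ≥ 2` grows slower than any
positive multiple of `z ^ 2`. -/
theorem ae_exists_abs_le {W : ℝ → Ω → ℝ} {P : Measure Ω} {p : ℕ} {q C : ℝ}
    (hmeas : ∀ t, AEMeasurable (W t) P) (hcont : ∀ᵐ ω ∂P, Continuous fun t => W t ω) (hp : 2 ≤ p)
    (hq : 1 < q) (hC : 0 ≤ C) (hmom : HasMomentBound W P p q C) {ε : ℝ} (hε : 0 < ε) :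
    ∀ᵐ ω ∂P, ∃ M, ∀ z, |W z ω| ≤ M + ε * z ^ 2 := by
  obtain ⟨r, hr0, hr1, A, hA, hE⟩ := exists_lintegral_dyadicEnergy_le hmeas hq hC hmom
  have hr' : 0 < 1 - r := by linarith
  -- Chaining divides by `1 - r`, so this leaves an oscillation of ε/4 times n + 1. Two factors of 2
  -- follow: one on the negative half-line, one in `exists_abs_le_of_oscillation`.
  set η : ℝ := ε / 4 * (1 - r) with hη
  have hηpos : 0 < η := by positivity
  have h1 := ae_eventually_le_of_lintegral_le
    (fun n : ℕ => aemeasurable_dyadicEnergy hmeas p (ENNReal.ofReal r) (n : ℝ)) hA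
    (fun n => hE _) (pow_pos hηpos p)
  have h2 := ae_eventually_le_of_lintegral_le
    (fun n : ℕ => aemeasurable_dyadicEnergy hmeas p (ENNReal.ofReal r) (-((n : ℝ) + 1))) hA
    (fun n => hE _) (pow_pos hηpos p)
  have hosc : ∀ (w : ℝ → ℝ), Continuous w → ∀ (n : ℕ) (c : ℝ),
      dyadicEnergy p (ENNReal.ofReal r) w c ≤ ENNReal.ofReal (η ^ p * ((n : ℝ) + 1) ^ 2) →
      ∀ x ∈ Set.Icc c (c + 1), |w x - w c| ≤ ε / 4 * (n + 1) := by
    intro w hw n c h x hx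
    have hn : (1 : ℝ) ≤ n + 1 := by linarith [(Nat.cast_nonneg n : (0 : ℝ) ≤ n)]
    have := abs_sub_le_of_dyadicEnergy_le (by omega) hr0 hr1 (M := η * (n + 1)) (by positivity) hw
      (h.trans (ENNReal.ofReal_le_ofReal ?_)) hx
    · refine this.trans_eq ?_
      rw [hη]
      field_simp
    -- Here `p ≥ 2` matters: the bound (n + 1)² on the energy is at most (n + 1)^p, so its `p`-th
    -- root grows at most linearly.
    · exact (mul_le_mul_of_nonneg_left (pow_le_pow_right₀ hn hp) (by positivity)).trans_eq
        (mul_pow _ _ _).symm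
  filter_upwards [hcont, h1, h2] with ω hω h1 h2
  obtain ⟨C₁, hC₁⟩ := exists_abs_le_of_oscillation hω (ε := ε / 2) (by positivity) (by
    filter_upwards [h1] with n hn x hx
    refine (hosc _ hω n n hn x hx).trans ?_
    gcongr
    linarith)
  obtain ⟨C₂, hC₂⟩ := exists_abs_le_of_oscillation (w := fun t => W (-t) ω) (ε := ε / 2)
    (by fun_prop) (by positivity) (by
    filter_upwards [h2] with n hn x hx
    -- The cell `[-(n + 1), -n]` is anchored at its left endpoint, whereas the reflected path starts
    -- at `-n`; passing through the anchor doubles the bound.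
    have a1 := hosc _ hω n _ hn (-x) ⟨by linarith [hx.2], by linarith [hx.1]⟩
    have a2 := hosc _ hω n _ hn (-n) ⟨by linarith, by linarith⟩
    have a3 := abs_sub_le (W (-x) ω) (W (-((n : ℝ) + 1)) ω) (W (-(n : ℝ)) ω)
    rw [abs_sub_comm (W (-((n : ℝ) + 1)) ω)] at a3
    linarith)
  refine ⟨max C₁ C₂, fun z => ?_⟩
  rcases le_total 0 z with hz | hz
  · have := hC₁ z hz
    linarith [le_max_left C₁ C₂]
  · have := hC₂ (-z) (by linarith)
    rw [neg_neg, neg_sq] at this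
    linarith [le_max_right C₁ C₂]

/-- Almost sure regularity of the slope processes for a driving process with stationary increments,
continuous paths and Kolmogorov moment bounds. -/
theorem ae_regularSlopes {W : ℝ → Ω → ℝ} {P : Measure Ω} [IsProbabilityMeasure P] {a b : ℝ}
    (ha : 0 < a) (hb : 0 < b) {p : ℕ} {q C : ℝ}
    (hmeas : ∀ t, AEMeasurable (W t) P) (hcont : ∀ᵐ ω ∂P, Continuous fun t => W t ω)
    (hstat : HasStationaryIncrements W P) (hp : 2 ≤ p)
    (hq : 1 < q) (hC : 0 ≤ C) (hmom : HasMomentBound W P p q C) :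
    ∀ᵐ ω ∂P, RegularSlopes (driftedPath a b W ω) := by
  filter_upwards [hcont, ae_noKinkAtZero (a := a) (b := b) hmeas hstat hcont,
    ae_exists_abs_le hmeas hcont hp hq hC hmom (ε := b / (2 * a)) (by positivity)]
    with ω hω hkink ⟨M, hM⟩
  refine regularSlopes_of_noKinkAtZero (m := b / 2) (C := a * M) ?_ (by positivity) (fun z => ?_)
    hkink
  · unfold driftedPath
    fun_prop
  · unfold driftedPath
    have h1 := (abs_le.1 (hM z)).1
    have h2 : a * (-(M + b / (2 * a) * z ^ 2)) ≤ a * W z ω := mul_le_mul_of_nonneg_left h1 ha.le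
    have e : a * (-(M + b / (2 * a) * z ^ 2)) = -(a * M) - b / 2 * z ^ 2 := by
      field_simp
      ring
    linarith

end RandomPaths

/-! ### Increments of Brownian motion -/

section Brownian

variable {Ω : Type*} [MeasurableSpace Ω] {P : Measure Ω}

/-- Two Gaussian vectors with the same means and covariances have the same law. -/
theorem map_eq_of_gaussian_of_covariance_eq {ι : Type*} [Finite ι] {X Y : ι → Ω → ℝ}
    (hX : HasGaussianLaw (fun ω i => X i ω) P) (hY : HasGaussianLaw (fun ω i => Y i ω) P)
    (hmean : ∀ i, ∫ ω, X i ω ∂P = ∫ ω, Y i ω ∂P)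
    (hcov : ∀ i j, cov[X i, X j; P] = cov[Y i, Y j; P]) :
    P.map (fun ω i => X i ω) = P.map (fun ω i => Y i ω) := by
  classical
  have := hX.isProbabilityMeasure
  let := Fintype.ofFinite ι
  have := Measure.isFiniteMeasure_map P (fun ω i => X i ω)
  have := Measure.isFiniteMeasure_map P (fun ω i => Y i ω)
  refine Measure.ext_of_charFunDual (funext fun L => ?_)
  rw [hX.charFunDual_map_eq_fun, hY.charFunDual_map_eq_fun]
  obtain ⟨c, hL⟩ : ∃ c : ι → ℝ, ∀ x : ι → ℝ, L x = ∑ i, c i * x i :=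
    ⟨fun i => L (Pi.single i 1), fun x => by
      conv_lhs => rw [pi_eq_sum_univ' x]
      simp [map_sum, mul_comm, Pi.single]⟩
  have hXm : ∀ i, MemLp (X i) 2 P := fun i => (hX.eval i).memLp_two
  have hYm : ∀ i, MemLp (Y i) 2 P := fun i => (hY.eval i).memLp_two
  have e1 : ∫ ω, L (fun i => X i ω) ∂P = ∫ ω, L (fun i => Y i ω) ∂P := by
    simp_rw [hL]
    rw [integral_finsetSum _ fun i _ => ((hX.eval i).integrable).const_mul _,
      integral_finsetSum _ fun i _ => ((hY.eval i).integrable).const_mul _]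
    simp_rw [integral_const_mul, hmean]
  have e2 : Var[fun ω => L (fun i => X i ω); P] = Var[fun ω => L (fun i => Y i ω); P] := by
    simp_rw [hL]
    rw [variance_fun_sum fun i => (hXm i).const_mul _, variance_fun_sum fun i => (hYm i).const_mul _]
    simp_rw [covariance_const_mul_left, covariance_const_mul_right, hcov]
  rw [e2]
  congr 3
  rw [e1]

variable {B : ℝ → Ω → ℝ}

namespace IsTwoSidedBrownian

theorem memLp (hB : IsTwoSidedBrownian B P) (t : ℝ) : MemLp (B t) 2 P :=
  (hB.isGaussianProcess.hasGaussianLaw_eval t).memLp_two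

theorem hasGaussianLaw_increments (hB : IsTwoSidedBrownian B P) {ι : Type*} [Finite ι]
    (u v : ι → ℝ) : HasGaussianLaw (fun ω i => B (u i) ω - B (v i) ω) P := by
  classical
  have h : IsGaussianProcess (fun (i : ι) ω => B (u i) ω - B (v i) ω) P :=
    hB.isGaussianProcess.of_isGaussianProcess fun i => ⟨{u i, v i},
      { toFun x := x ⟨u i, by simp⟩ - x ⟨v i, by simp⟩
        map_add' x y := by simp; abel
        map_smul' c x := by simp; ring },
      by simp⟩
  let := Fintype.ofFinite ι
  exact (h.hasGaussianLaw Finset.univ).map_fun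
    (ContinuousLinearMap.pi fun i => ContinuousLinearMap.proj (R := ℝ)
      (φ := fun _ : (Finset.univ : Finset ι) => ℝ) ⟨i, Finset.mem_univ i⟩)

theorem integral_increment (hB : IsTwoSidedBrownian B P) (s t : ℝ) :
    ∫ ω, (B t ω - B s ω) ∂P = 0 := by
  have := hB.isGaussianProcess.isProbabilityMeasure
  rw [integral_sub ((hB.memLp t).integrable one_le_two) ((hB.memLp s).integrable one_le_two),
    hB.mean_zero, hB.mean_zero, sub_zero]

theorem covariance_increments (hB : IsTwoSidedBrownian B P) (s t u v : ℝ) :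
    cov[fun ω => B t ω - B s ω, fun ω => B v ω - B u ω; P] =
      (|t - u| + |s - v| - |t - v| - |s - u|) / 2 := by
  have := hB.isGaussianProcess.isProbabilityMeasure
  rw [covariance_fun_sub_fun_sub (hB.memLp t) (hB.memLp s) (hB.memLp v) (hB.memLp u)]
  simp only [hB.covariance_eq]
  ring

theorem variance_increment (hB : IsTwoSidedBrownian B P) {s t : ℝ} (hst : s ≤ t) :
    Var[fun ω => B t ω - B s ω; P] = t - s := by
  have hm : AEMeasurable (fun ω => B t ω - B s ω) P :=
    ((hB.memLp t).sub (hB.memLp s)).aestronglyMeasurable.aemeasurable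
  rw [← covariance_self hm]
  have := hB.covariance_increments s t s t
  rw [abs_of_nonneg (sub_nonneg.2 hst), abs_of_nonpos (sub_nonpos.2 hst)] at this
  simp only [sub_self, abs_zero] at this
  rw [show (t - s + -(s - t) - 0 - 0) / 2 = t - s by ring] at this
  exact this

/-- Increments are centred and their covariances depend only on time differences; a Gaussian law is
determined by these data. -/
theorem map_increments_eq (hB : IsTwoSidedBrownian B P) {ι : Type*} [Finite ι] (u v : ι → ℝ)
    (s : ℝ) : P.map (fun ω i => B (s + u i) ω - B (s + v i) ω) =
      P.map (fun ω i => B (u i) ω - B (v i) ω) := by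
  refine map_eq_of_gaussian_of_covariance_eq (X := fun i ω => B (s + u i) ω - B (s + v i) ω)
    (Y := fun i ω => B (u i) ω - B (v i) ω) (hB.hasGaussianLaw_increments _ _)
    (hB.hasGaussianLaw_increments _ _) (fun i => ?_) (fun i j => ?_)
  · rw [hB.integral_increment, hB.integral_increment]
  · rw [hB.covariance_increments, hB.covariance_increments]
    simp only [add_sub_add_left_eq_sub]

theorem hasStationaryIncrements (hB : IsTwoSidedBrownian B P) : HasStationaryIncrements B P := by
  intro s I
  have h1 := hB.map_increments_eq (ι := I) (fun z => 0 + ((z : ℚ) : ℝ)) (fun _ => 0) s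
  simpa using h1

theorem hasLaw_increment (hB : IsTwoSidedBrownian B P) {s t : ℝ} (hst : s ≤ t) :
    P.map (fun ω => B t ω - B s ω) = gaussianReal 0 (t - s).toNNReal := by
  have h := (hB.isGaussianProcess.hasGaussianLaw_fun_sub (s := t) (t := s)).map_eq_gaussianReal
  rw [hB.integral_increment, hB.variance_increment hst] at h
  exact h

end IsTwoSidedBrownian

theorem lintegral_pow_four_gaussianReal (v : NNReal) :
    ∫⁻ x, ‖x‖ₑ ^ 4 ∂gaussianReal 0 v = (v : ENNReal) ^ 2 * ∫⁻ x, ‖x‖ₑ ^ 4 ∂gaussianReal 0 1 := by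
  have h := gaussianReal_map_const_mul (μ := 0) (v := 1) (Real.sqrt v)
  have e : (NNReal.mk (Real.sqrt v ^ 2) (sq_nonneg _) * 1 : NNReal) = v := by
    ext
    simp
  rw [e, mul_zero] at h
  rw [← h, lintegral_map (by fun_prop) (by fun_prop)]
  simp_rw [enorm_mul, mul_pow]
  rw [lintegral_const_mul _ (by fun_prop)]
  congr 1
  rw [Real.enorm_of_nonneg (Real.sqrt_nonneg _), ← ENNReal.ofReal_pow (Real.sqrt_nonneg _),
    show Real.sqrt v ^ 4 = (Real.sqrt v ^ 2) ^ 2 by ring, Real.sq_sqrt v.coe_nonneg,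
    ENNReal.ofReal_pow v.coe_nonneg]
  simp

/-- The fourth moment is used because the second is only of order t - s, which misses the exponent q
> 1. Finiteness comes from the standard Gaussian and scaling. -/
theorem IsTwoSidedBrownian.exists_hasMomentBound (hB : IsTwoSidedBrownian B P) :
    ∃ C, 0 ≤ C ∧ HasMomentBound B P 4 2 C := by
  have hfin : ∫⁻ x, ‖x‖ₑ ^ 4 ∂gaussianReal 0 1 ≠ ⊤ := by
    have h := (memLp_id_gaussianReal (μ := 0) (v := 1) 4).eLpNorm_lt_top
    have h' := lintegral_rpow_enorm_lt_top_of_eLpNorm_lt_top (by norm_num) (by norm_num) h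
    have e : ((4 : NNReal) : ENNReal).toReal = ((4 : ℕ) : ℝ) := by norm_num
    simp only [e, ENNReal.rpow_natCast, id] at h'
    exact h'.ne
  refine ⟨(∫⁻ x, ‖x‖ₑ ^ 4 ∂gaussianReal 0 1).toReal, ENNReal.toReal_nonneg, fun s t hst => ?_⟩
  have h1 : ∫⁻ ω, ‖B t ω - B s ω‖ₑ ^ 4 ∂P =
      ∫⁻ x, ‖x‖ₑ ^ 4 ∂(P.map fun ω => B t ω - B s ω) := by
    have hm : AEMeasurable (fun ω => B t ω - B s ω) P :=
      ((hB.memLp t).sub (hB.memLp s)).aestronglyMeasurable.aemeasurable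
    rw [lintegral_map' (by fun_prop) hm]
  rw [h1, hB.hasLaw_increment hst, lintegral_pow_four_gaussianReal,
    ENNReal.ofReal_mul ENNReal.toReal_nonneg, ENNReal.ofReal_toReal hfin, mul_comm]
  gcongr
  rw [Real.rpow_ofNat, ENNReal.ofReal_pow (sub_nonneg.2 hst)]
  rfl

end Brownian

/-! ### Elementary integrands on a common grid -/

namespace OffDiagStep

variable {r : ℕ}

/-- The multilinear expression that specializes both to the step function of `φ` and to its multiple
Wiener integral. -/
def eval (φ : OffDiagStep r) (F : Fin r → ℝ → ℝ) : ℝ :=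
  ∑ i : Fin r → Fin φ.N, φ.coeff i *
    ∏ j, (F j (φ.pt (i j).succ) - F j (φ.pt (i j).castSucc))

theorem indicator_Ioc_eq_sub {a b : ℝ} (hab : a ≤ b) (x : ℝ) :
    (Set.Ioc a b).indicator (fun _ => (1 : ℝ)) x =
      (if x ≤ b then (1 : ℝ) else 0) - if x ≤ a then (1 : ℝ) else 0 := by
  by_cases h1 : x ≤ a
  · simp [h1, h1.trans hab]
  · by_cases h2 : x ≤ b <;> simp [h1, h2, not_le.1 h1]

theorem pt_castSucc_lt (φ : OffDiagStep r) (l : Fin φ.N) : φ.pt l.castSucc < φ.pt l.succ :=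
  φ.strictMono_pt (Fin.castSucc_lt_succ)

theorem toFun_eq_eval (φ : OffDiagStep r) (x : Fin r → ℝ) :
    φ.toFun x = φ.eval fun j y => if x j ≤ y then 1 else 0 := by
  unfold toFun eval
  refine Finset.sum_congr rfl fun i _ => ?_
  congr 1
  exact Finset.prod_congr rfl fun j _ => indicator_Ioc_eq_sub (φ.pt_castSucc_lt _).le _

/-- A telescoping sum over the cells between `m₁` and `m₂`. -/
theorem sum_ite_sub_eq {M : ℕ} (f : Fin (M + 1) → ℝ) {m₁ m₂ : Fin (M + 1)} (h : m₁ ≤ m₂) :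
    (∑ l : Fin M, if m₁ ≤ l.castSucc ∧ l.succ ≤ m₂ then f l.succ - f l.castSucc else 0) =
      f m₂ - f m₁ := by
  set g : ℕ → ℝ := fun n => if hn : n < M + 1 then f ⟨n, hn⟩ else 0 with hg
  have hgf : ∀ m : Fin (M + 1), g m = f m := fun m => dif_pos m.2
  have h1 : (∑ l : Fin M, if m₁ ≤ l.castSucc ∧ l.succ ≤ m₂ then f l.succ - f l.castSucc else 0) =
      ∑ l ∈ Finset.range M,
        if (m₁ : ℕ) ≤ l ∧ l + 1 ≤ (m₂ : ℕ) then g (l + 1) - g l else 0 := by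
    rw [← Fin.sum_univ_eq_sum_range]
    refine Finset.sum_congr rfl fun l _ => ?_
    have e1 : g ((l : ℕ) + 1) = f l.succ := by rw [← hgf]; simp
    have e2 : g (l : ℕ) = f l.castSucc := by rw [← hgf]; simp
    rw [e1, e2]
    simp [Fin.le_def]
  rw [h1, ← Finset.sum_filter]
  have h2 : (Finset.range M).filter (fun l => (m₁ : ℕ) ≤ l ∧ l + 1 ≤ (m₂ : ℕ)) =
      Finset.Ico (m₁ : ℕ) m₂ := by
    ext l
    have := m₂.2
    simp only [Finset.mem_filter, Finset.mem_range, Finset.mem_Ico]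
    omega
  rw [h2, Finset.sum_Ico_sub _ (Fin.le_def.1 h), hgf, hgf]

/-- The entry of the incidence matrix between the cells of a grid and those of a finer one. -/
def cellMatrix {N M : ℕ} (pt : Fin (N + 1) → ℝ) (q : Fin (M + 1) → ℝ) (k : Fin N) (l : Fin M) : ℝ :=
  if pt k.castSucc ≤ q l.castSucc ∧ q l.succ ≤ pt k.succ then 1 else 0

theorem sum_cellMatrix {N M : ℕ} {pt : Fin (N + 1) → ℝ} {q : Fin (M + 1) → ℝ}
    (hpt : StrictMono pt) (hq : StrictMono q) (hsub : ∀ k, ∃ m, q m = pt k) (F : ℝ → ℝ)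
    (k : Fin N) : ∑ l, cellMatrix pt q k l * (F (q l.succ) - F (q l.castSucc)) =
      F (pt k.succ) - F (pt k.castSucc) := by
  obtain ⟨m₁, h₁⟩ := hsub k.castSucc
  obtain ⟨m₂, h₂⟩ := hsub k.succ
  have hlt : m₁ < m₂ := hq.lt_iff_lt.1 (by rw [h₁, h₂]; exact hpt Fin.castSucc_lt_succ)
  rw [← h₁, ← h₂, ← sum_ite_sub_eq (fun m => F (q m)) hlt.le]
  refine Finset.sum_congr rfl fun l _ => ?_
  simp only [cellMatrix, ← h₁, ← h₂, hq.le_iff_le]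
  split_ifs <;> simp

theorem cellMatrix_injective {N M : ℕ} {pt : Fin (N + 1) → ℝ} {q : Fin (M + 1) → ℝ}
    (hpt : StrictMono pt) (hq : StrictMono q) {k k' : Fin N} {l : Fin M}
    (h : cellMatrix pt q k l ≠ 0) (h' : cellMatrix pt q k' l ≠ 0) : k = k' := by
  simp only [cellMatrix, ne_eq, ite_eq_right_iff, one_ne_zero, imp_false, not_not] at h h'
  have hl : q l.castSucc < q l.succ := hq Fin.castSucc_lt_succ
  have h1 := hpt.lt_iff_lt.1 ((h.1.trans_lt hl).trans_le h'.2)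
  have h2 := hpt.lt_iff_lt.1 ((h'.1.trans_lt hl).trans_le h.2)
  rw [Fin.lt_def] at h1 h2
  simp only [Fin.val_castSucc, Fin.val_succ] at h1 h2
  ext
  omega

/-- The same elementary integrand, described on a finer grid. -/
def refine (φ : OffDiagStep r) {M : ℕ} (q : Fin (M + 1) → ℝ) (hq : StrictMono q) :
    OffDiagStep r where
  N := M
  pt := q
  strictMono_pt := hq
  coeff i' := ∑ i : Fin r → Fin φ.N, φ.coeff i * ∏ j, cellMatrix φ.pt q (i j) (i' j)
  coeff_eq_zero i' hi' := by
    refine Finset.sum_eq_zero fun i _ => ?_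
    by_contra hne
    have h1 : φ.coeff i ≠ 0 := left_ne_zero_of_mul hne
    have h2 := Finset.prod_ne_zero_iff.1 (right_ne_zero_of_mul hne)
    have hi : Function.Injective i := by
      by_contra hi
      exact h1 (φ.coeff_eq_zero i hi)
    -- A fine cell lies in at most one coarse cell, so a repeated fine index would repeat a coarse
    -- one, where the coefficient vanishes.
    refine hi' fun j j' hjj => hi ?_
    refine cellMatrix_injective φ.strictMono_pt hq (h2 j (Finset.mem_univ j)) ?_
    rw [hjj]
    exact h2 j' (Finset.mem_univ j')

theorem eval_refine (φ : OffDiagStep r) {M : ℕ} {q : Fin (M + 1) → ℝ} (hq : StrictMono q)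
    (hsub : ∀ k, ∃ m, q m = φ.pt k) (F : Fin r → ℝ → ℝ) :
    (φ.refine q hq).eval F = φ.eval F := by
  unfold eval refine
  simp only
  simp_rw [← sum_cellMatrix φ.strictMono_pt hq hsub, Fintype.prod_sum, Finset.sum_mul,
    Finset.mul_sum]
  rw [Finset.sum_comm]
  refine Finset.sum_congr rfl fun i _ => Finset.sum_congr rfl fun i' _ => ?_
  rw [Finset.prod_mul_distrib, mul_assoc]

theorem exists_common_grid (φ ψ : OffDiagStep r) : ∃ (M : ℕ) (q : Fin (M + 1) → ℝ),
    StrictMono q ∧ (∀ k, ∃ m, q m = φ.pt k) ∧ ∀ k, ∃ m, q m = ψ.pt k := by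
  classical
  set S : Finset ℝ := Finset.univ.image φ.pt ∪ Finset.univ.image ψ.pt with hS
  have hcard : S.card = (S.card - 1) + 1 := by
    have : 0 < S.card := Finset.card_pos.2 ⟨φ.pt 0, by simp [hS]⟩
    omega
  have hrange := S.range_orderEmbOfFin hcard
  refine ⟨S.card - 1, S.orderEmbOfFin hcard, (S.orderEmbOfFin hcard).strictMono, fun k => ?_,
    fun k => ?_⟩
  · have : φ.pt k ∈ Set.range (S.orderEmbOfFin hcard) := by rw [hrange]; simp [hS]
    exact this
  · have : ψ.pt k ∈ Set.range (S.orderEmbOfFin hcard) := by rw [hrange]; simp [hS]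
    exact this

/-- Valid for arbitrary `F`, so one `χ` represents both the difference of the step functions and the
difference of their integrals. -/
theorem exists_eval_sub (φ ψ : OffDiagStep r) :
    ∃ χ : OffDiagStep r, ∀ F, χ.eval F = φ.eval F - ψ.eval F := by
  obtain ⟨M, q, hq, h1, h2⟩ := exists_common_grid φ ψ
  refine ⟨⟨M, q, hq, fun i => (φ.refine q hq).coeff i - (ψ.refine q hq).coeff i, fun i hi => ?_⟩,
    fun F => ?_⟩
  · rw [(φ.refine q hq).coeff_eq_zero i hi, (ψ.refine q hq).coeff_eq_zero i hi, sub_zero]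
  · rw [← eval_refine φ hq h1, ← eval_refine ψ hq h2]
    unfold eval
    simp only [sub_mul, Finset.sum_sub_distrib]
    rfl

/-! ### The second moment of an elementary multiple integral -/

/-- The length of a grid cell. -/
def len (φ : OffDiagStep r) (l : Fin φ.N) : ℝ := φ.pt l.succ - φ.pt l.castSucc

theorem len_nonneg (φ : OffDiagStep r) (l : Fin φ.N) : 0 ≤ φ.len l :=
  (sub_pos.2 (φ.pt_castSucc_lt l)).le

/-- Distinct boxes of a grid are disjoint, so the cross terms vanish. -/
theorem toFun_sq (φ : OffDiagStep r) (x : Fin r → ℝ) : φ.toFun x ^ 2 =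
    ∑ i : Fin r → Fin φ.N, φ.coeff i ^ 2 *
      ∏ j, (Set.Ioc (φ.pt (i j).castSucc) (φ.pt (i j).succ)).indicator (fun _ => (1 : ℝ)) (x j) := by
  unfold toFun
  rw [sq, Finset.sum_mul_sum]
  refine Finset.sum_congr rfl fun i _ => ?_
  rw [Finset.sum_eq_single i]
  · rw [mul_mul_mul_comm, ← sq, ← Finset.prod_mul_distrib]
    congr 1
    refine Finset.prod_congr rfl fun j _ => ?_
    by_cases h : x j ∈ Set.Ioc (φ.pt (i j).castSucc) (φ.pt (i j).succ) <;> simp [h]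
  · intro i' _ hne
    obtain ⟨j, hj⟩ := Function.ne_iff.1 hne
    rw [mul_mul_mul_comm, ← Finset.prod_mul_distrib, Finset.prod_eq_zero (Finset.mem_univ j),
      mul_zero]
    by_contra h
    have h1 := Set.mem_of_indicator_ne_zero (left_ne_zero_of_mul h)
    have h2 := Set.mem_of_indicator_ne_zero (right_ne_zero_of_mul h)
    have h3 := φ.strictMono_pt.lt_iff_lt.1 (h1.1.trans_le h2.2)
    have h4 := φ.strictMono_pt.lt_iff_lt.1 (h2.1.trans_le h1.2)
    rw [Fin.lt_def] at h3 h4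
    simp only [Fin.val_castSucc, Fin.val_succ] at h3 h4
    exact hj (Fin.ext (by omega))
  · simp

theorem integrable_prod_indicator (φ : OffDiagStep r) (i : Fin r → Fin φ.N) :
    Integrable fun x : Fin r → ℝ => ∏ j,
      (Set.Ioc (φ.pt (i j).castSucc) (φ.pt (i j).succ)).indicator (fun _ => (1 : ℝ)) (x j) := by
  refine Integrable.fintype_prod (f := fun j =>
    (Set.Ioc (φ.pt (i j).castSucc) (φ.pt (i j).succ)).indicator (fun _ => (1 : ℝ))) fun j => ?_
  exact (integrable_indicator_iff measurableSet_Ioc).2 (by simp)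

theorem integrable_toFun_sq (φ : OffDiagStep r) : Integrable fun x => φ.toFun x ^ 2 := by
  simp_rw [toFun_sq]
  exact integrable_finsetSum _ fun i _ => (φ.integrable_prod_indicator i).const_mul _

theorem aestronglyMeasurable_toFun (φ : OffDiagStep r) :
    AEStronglyMeasurable φ.toFun volume := by
  have : Integrable φ.toFun := integrable_finsetSum _ fun i _ =>
    (φ.integrable_prod_indicator i).const_mul _
  exact this.aestronglyMeasurable

theorem memLp_toFun (φ : OffDiagStep r) : MemLp φ.toFun 2 volume :=
  (memLp_two_iff_integrable_sq φ.aestronglyMeasurable_toFun).2 φ.integrable_toFun_sq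

theorem integral_toFun_sq (φ : OffDiagStep r) :
    ∫ x, φ.toFun x ^ 2 = ∑ i : Fin r → Fin φ.N, φ.coeff i ^ 2 * ∏ j, φ.len (i j) := by
  simp_rw [toFun_sq]
  rw [integral_finsetSum _ fun i _ => (φ.integrable_prod_indicator i).const_mul _]
  refine Finset.sum_congr rfl fun i _ => ?_
  rw [integral_const_mul, integral_fintype_prod_volume_eq_prod (fun j =>
    (Set.Ioc (φ.pt (i j).castSucc) (φ.pt (i j).succ)).indicator (fun _ => (1 : ℝ)))]
  congr 1
  refine Finset.prod_congr rfl fun j _ => ?_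
  rw [integral_indicator_const _ measurableSet_Ioc]
  simp only [Measure.real, Real.volume_Ioc, smul_eq_mul, mul_one]
  exact ENNReal.toReal_ofReal (φ.len_nonneg _)

section Moments

variable {Ω : Type*} [MeasurableSpace Ω] {P : Measure Ω} {B : ℝ → Ω → ℝ}

/-- The increment of `B` over a cell of the grid. -/
def incr (φ : OffDiagStep r) (B : ℝ → Ω → ℝ) (l : Fin φ.N) (ω : Ω) : ℝ :=
  B (φ.pt l.succ) ω - B (φ.pt l.castSucc) ω

theorem hasGaussianLaw_incr (hB : IsTwoSidedBrownian B P) (φ : OffDiagStep r) :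
    HasGaussianLaw (fun ω l => φ.incr B l ω) P :=
  hB.hasGaussianLaw_increments (fun l : Fin φ.N => φ.pt l.succ) fun l => φ.pt l.castSucc

theorem iIndepFun_incr (hB : IsTwoSidedBrownian B P) (φ : OffDiagStep r) :
    iIndepFun (φ.incr B) P := by
  refine (hasGaussianLaw_incr hB φ).iIndepFun_of_covariance_eq_zero fun l l' hne => ?_
  unfold incr
  rw [hB.covariance_increments]
  have h1 := φ.pt_castSucc_lt l
  have h2 := φ.pt_castSucc_lt l'
  rcases hne.lt_or_gt with h | h
  · have h3 : φ.pt l.succ ≤ φ.pt l'.castSucc := φ.strictMono_pt.monotone (by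
      rw [Fin.lt_def] at h; rw [Fin.le_def]; simpa using h)
    rw [abs_of_nonpos (by linarith), abs_of_nonpos (by linarith), abs_of_nonpos (by linarith),
      abs_of_nonpos (by linarith)]
    ring
  · have h3 : φ.pt l'.succ ≤ φ.pt l.castSucc := φ.strictMono_pt.monotone (by
      rw [Fin.lt_def] at h; rw [Fin.le_def]; simpa using h)
    rw [abs_of_nonneg (by linarith), abs_of_nonneg (by linarith), abs_of_nonneg (by linarith),
      abs_of_nonneg (by linarith)]
    ring

theorem integral_incr (hB : IsTwoSidedBrownian B P) (φ : OffDiagStep r) (l : Fin φ.N) :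
    ∫ ω, φ.incr B l ω ∂P = 0 := hB.integral_increment _ _

theorem integral_incr_mul_self (hB : IsTwoSidedBrownian B P) (φ : OffDiagStep r) (l : Fin φ.N) :
    ∫ ω, φ.incr B l ω * φ.incr B l ω ∂P = φ.len l := by
  have h : Var[fun ω => φ.incr B l ω; P] = φ.len l :=
    hB.variance_increment (φ.pt_castSucc_lt l).le
  rw [variance_of_integral_eq_zero ((hasGaussianLaw_incr hB φ).aemeasurable.eval l)
    (integral_incr hB φ l)] at h
  simp only [← sq]
  exact h

/-- Each product is bounded by the `r`-th power of the sup norm of a Gaussian vector, which has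
moments of all orders. -/
theorem integrable_prod_incr_mul (hB : IsTwoSidedBrownian B P) (φ : OffDiagStep r)
    (i i' : Fin r → Fin φ.N) :
    Integrable (fun ω => (∏ j, φ.incr B (i j) ω) * ∏ j, φ.incr B (i' j) ω) P := by
  have hG := hasGaussianLaw_incr hB φ
  have := hG.isProbabilityMeasure
  have hm : ∀ l, AEStronglyMeasurable (φ.incr B l) P := fun l =>
    (hG.aemeasurable.eval l).aestronglyMeasurable
  have hint : Integrable (fun ω => ‖fun l => φ.incr B l ω‖ ^ (r + r)) P :=
    (hG.memLp (p := ((r + r : ℕ) : ENNReal)) (ENNReal.natCast_ne_top _)).integrable_norm_pow'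
  refine hint.mono ((Finset.aestronglyMeasurable_fun_prod _ fun j _ => hm _).mul
    (Finset.aestronglyMeasurable_fun_prod _ fun j _ => hm _)) (Eventually.of_forall fun ω => ?_)
  have hb : ∀ i : Fin r → Fin φ.N, ‖∏ j, φ.incr B (i j) ω‖ ≤ ‖fun l => φ.incr B l ω‖ ^ r := by
    intro i
    rw [norm_prod]
    refine (Finset.prod_le_prod (fun _ _ => norm_nonneg _)
      fun j _ => norm_le_pi_norm (fun l => φ.incr B l ω) (i j)).trans ?_
    simp
  rw [norm_mul, norm_pow, norm_norm, pow_add]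
  exact mul_le_mul (hb i) (hb i') (norm_nonneg _) (by positivity)

/-- By injectivity each cell occurs at most once in each product. Regrouped by independent cells, a
common cell contributes its length and a cell in only one of the products contributes zero. -/
theorem integral_prod_incr_mul (hB : IsTwoSidedBrownian B P) (φ : OffDiagStep r)
    {i i' : Fin r → Fin φ.N} (hi : Function.Injective i) (hi' : Function.Injective i') :
    ∫ ω, (∏ j, φ.incr B (i j) ω) * ∏ j, φ.incr B (i' j) ω ∂P =
      if Finset.univ.image i = Finset.univ.image i' then ∏ j, φ.len (i j) else 0 := by
  classical
  have := hB.isGaussianProcess.isProbabilityMeasure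
  set S := Finset.univ.image i with hS
  set S' := Finset.univ.image i' with hS'
  have hprod : ∀ (v : Fin φ.N → ℝ) (k : Fin r → Fin φ.N), Function.Injective k →
      ∏ j, v (k j) = ∏ l, if l ∈ Finset.univ.image k then v l else 1 := by
    intro v k hk
    rw [Finset.prod_ite_mem, Finset.univ_inter, Finset.prod_image fun a _ b _ h => hk h]
  set g : Fin φ.N → ℝ → ℝ := fun l x => (if l ∈ S then x else 1) * if l ∈ S' then x else 1 with hg
  have e1 : ∀ ω, (∏ j, φ.incr B (i j) ω) * ∏ j, φ.incr B (i' j) ω =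
      ∏ l, g l (φ.incr B l ω) := fun ω => by
    rw [hprod (fun l => φ.incr B l ω) i hi, hprod (fun l => φ.incr B l ω) i' hi',
      ← Finset.prod_mul_distrib]
  have hgm : ∀ l, Measurable (g l) := fun l => by
    simp only [hg]
    refine Measurable.mul ?_ ?_ <;> split_ifs <;> fun_prop
  simp_rw [e1]
  rw [(iIndepFun_incr hB φ).integral_fun_prod_comp
    (fun l => (hasGaussianLaw_incr hB φ).aemeasurable.eval l)
    fun l => (hgm l).aestronglyMeasurable]
  split_ifs with h
  · rw [hprod φ.len i hi]
    refine Finset.prod_congr rfl fun l _ => ?_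
    simp only [hg, ← h, ← hS]
    split_ifs with hl
    · exact integral_incr_mul_self hB φ l
    · simp
  · obtain ⟨l, hl⟩ : ∃ l, ¬ (l ∈ S ↔ l ∈ S') := by
      by_contra! hall
      exact h (Finset.ext hall)
    refine Finset.prod_eq_zero (Finset.mem_univ l) ?_
    simp only [hg]
    by_cases h1 : l ∈ S <;> by_cases h2 : l ∈ S' <;> simp only [h1, h2, iff_true, iff_false,
      not_true, not_false_iff, if_true, if_false, mul_one, one_mul] at hl ⊢
    · exact integral_incr hB φ l
    · exact integral_incr hB φ l

theorem wienerIntegral_eq_sum {Ω : Type*} (φ : OffDiagStep r) (B : ℝ → Ω → ℝ) (ω : Ω) :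
    φ.wienerIntegral B ω = ∑ i, φ.coeff i * ∏ j, φ.incr B (i j) ω := rfl

theorem wienerIntegral_sq {Ω : Type*} (φ : OffDiagStep r) (B : ℝ → Ω → ℝ) (ω : Ω) :
    φ.wienerIntegral B ω ^ 2 =
    ∑ i, ∑ i', φ.coeff i * φ.coeff i' *
      ((∏ j, φ.incr B (i j) ω) * ∏ j, φ.incr B (i' j) ω) := by
  rw [wienerIntegral_eq_sum, sq, Finset.sum_mul_sum]
  refine Finset.sum_congr rfl fun i _ => Finset.sum_congr rfl fun i' _ => ?_
  ring

theorem integrable_wienerIntegral_sq (hB : IsTwoSidedBrownian B P) (φ : OffDiagStep r) :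
    Integrable (fun ω => φ.wienerIntegral B ω ^ 2) P := by
  simp_rw [wienerIntegral_sq]
  exact integrable_finsetSum _ fun i _ => integrable_finsetSum _ fun i' _ =>
    (integrable_prod_incr_mul hB φ i i').const_mul _

/-- Only pairs of indices with the same set of cells survive, and they share the same volume. The
product of coefficients is split by 2xy ≤ x² + y², and each `i` has at most `r ^ r` partners, since
these take values in its image. The constant is crude, but any finite one suffices. -/
theorem integral_wienerIntegral_sq_le (hB : IsTwoSidedBrownian B P) (φ : OffDiagStep r) :
    ∫ ω, φ.wienerIntegral B ω ^ 2 ∂P ≤ (r : ℝ) ^ r * ∫ x, φ.toFun x ^ 2 := by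
  classical
  simp_rw [wienerIntegral_sq]
  rw [integral_finsetSum _ fun i _ => integrable_finsetSum _ fun i' _ =>
    (integrable_prod_incr_mul hB φ i i').const_mul _]
  simp_rw [integral_finsetSum _ fun i' _ =>
    (integrable_prod_incr_mul hB φ _ i').const_mul _, integral_const_mul]
  set e : (Fin r → Fin φ.N) → (Fin r → Fin φ.N) → ℝ := fun i i' =>
    if ∀ j, i' j ∈ Finset.univ.image i then ∏ j, φ.len (i j) else 0 with he
  have hV : ∀ i : Fin r → Fin φ.N, 0 ≤ ∏ j, φ.len (i j) := fun i =>
    Finset.prod_nonneg fun j _ => φ.len_nonneg _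
  have he0 : ∀ i i', 0 ≤ e i i' := fun i i' => by
    simp only [he]
    split_ifs
    exacts [hV i, le_rfl]
  have hbound : ∀ i i', φ.coeff i * φ.coeff i' *
      ∫ ω, (∏ j, φ.incr B (i j) ω) * ∏ j, φ.incr B (i' j) ω ∂P ≤
      (φ.coeff i ^ 2 * e i i' + φ.coeff i' ^ 2 * e i' i) / 2 := by
    intro i i'
    have hnn : 0 ≤ (φ.coeff i ^ 2 * e i i' + φ.coeff i' ^ 2 * e i' i) / 2 := by
      have := mul_nonneg (sq_nonneg (φ.coeff i)) (he0 i i')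
      have := mul_nonneg (sq_nonneg (φ.coeff i')) (he0 i' i)
      linarith
    by_cases hi : Function.Injective i
    swap
    · rw [φ.coeff_eq_zero i hi, zero_mul, zero_mul]
      simpa [φ.coeff_eq_zero i hi] using hnn
    by_cases hi' : Function.Injective i'
    swap
    · rw [φ.coeff_eq_zero i' hi', mul_zero, zero_mul]
      simpa [φ.coeff_eq_zero i' hi'] using hnn
    rw [integral_prod_incr_mul hB φ hi hi']
    split_ifs with hS
    · have h1 : e i i' = ∏ j, φ.len (i j) := if_pos fun j => hS ▸ by simp
      have h2 : e i' i = ∏ j, φ.len (i' j) := if_pos fun j => hS ▸ by simp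
      have h3 : ∏ j, φ.len (i j) = ∏ j, φ.len (i' j) := by
        rw [← Finset.prod_image (s := Finset.univ) (g := i) (f := φ.len) fun a _ b _ h => hi h, hS,
          Finset.prod_image fun a _ b _ h => hi' h]
      rw [h1, h2, ← h3]
      nlinarith [mul_nonneg (sq_nonneg (φ.coeff i - φ.coeff i')) (hV i)]
    · simpa using hnn
  have hcount : ∀ i, ∑ i', e i i' ≤ (r : ℝ) ^ r * ∏ j, φ.len (i j) := by
    intro i
    simp only [he]
    rw [← Finset.sum_filter, Finset.sum_const, nsmul_eq_mul]
    refine mul_le_mul_of_nonneg_right ?_ (hV i)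
    have h1 : (Finset.univ.filter fun i' : Fin r → Fin φ.N =>
        ∀ j, i' j ∈ Finset.univ.image i) = Fintype.piFinset fun _ => Finset.univ.image i := by
      ext
      simp
    rw [h1, Fintype.card_piFinset]
    have h2 : (Finset.univ.image i).card ≤ r := by
      simpa using Finset.card_image_le (s := Finset.univ) (f := i)
    simp only [Finset.prod_const, Finset.card_univ, Fintype.card_fin]
    exact_mod_cast Nat.pow_le_pow_left h2 r
  calc _ ≤ ∑ i, ∑ i', (φ.coeff i ^ 2 * e i i' + φ.coeff i' ^ 2 * e i' i) / 2 :=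
        Finset.sum_le_sum fun i _ => Finset.sum_le_sum fun i' _ => hbound i i'
    _ = ∑ i, ∑ i', φ.coeff i ^ 2 * e i i' := by
        simp_rw [add_div, Finset.sum_add_distrib]
        rw [Finset.sum_comm (f := fun i i' => φ.coeff i' ^ 2 * e i' i / 2),
          ← Finset.sum_add_distrib]
        refine Finset.sum_congr rfl fun i _ => ?_
        rw [← Finset.sum_add_distrib]
        refine Finset.sum_congr rfl fun i' _ => ?_
        ring
    _ ≤ ∑ i, φ.coeff i ^ 2 * ((r : ℝ) ^ r * ∏ j, φ.len (i j)) := by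
        refine Finset.sum_le_sum fun i _ => ?_
        rw [← Finset.mul_sum]
        exact mul_le_mul_of_nonneg_left (hcount i) (sq_nonneg _)
    _ = _ := by
        rw [integral_toFun_sq, Finset.mul_sum]
        refine Finset.sum_congr rfl fun i _ => ?_
        ring

theorem aestronglyMeasurable_wienerIntegral (hB : IsTwoSidedBrownian B P) (φ : OffDiagStep r) :
    AEStronglyMeasurable (φ.wienerIntegral B) P :=
  Finset.aestronglyMeasurable_fun_sum _ fun _ _ => (Finset.aestronglyMeasurable_fun_prod _
    fun _ _ => ((hasGaussianLaw_incr hB φ).aemeasurable.eval _).aestronglyMeasurable).const_mul _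

theorem memLp_wienerIntegral (hB : IsTwoSidedBrownian B P) (φ : OffDiagStep r) :
    MemLp (φ.wienerIntegral B) 2 P :=
  (memLp_two_iff_integrable_sq (aestronglyMeasurable_wienerIntegral hB φ)).2
    (integrable_wienerIntegral_sq hB φ)

theorem eLpNorm_wienerIntegral_le (hB : IsTwoSidedBrownian B P) (φ : OffDiagStep r) :
    eLpNorm (φ.wienerIntegral B) 2 P ≤
      ENNReal.ofReal (Real.sqrt ((r : ℝ) ^ r)) * eLpNorm φ.toFun 2 volume := by
  rw [(memLp_wienerIntegral hB φ).eLpNorm_eq_integral_rpow_norm two_ne_zero ENNReal.ofNat_ne_top,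
    φ.memLp_toFun.eLpNorm_eq_integral_rpow_norm two_ne_zero ENNReal.ofNat_ne_top,
    ← ENNReal.ofReal_mul (Real.sqrt_nonneg _)]
  refine ENNReal.ofReal_le_ofReal ?_
  simp only [ENNReal.toReal_ofNat, Real.rpow_ofNat, Real.norm_eq_abs, sq_abs]
  rw [← one_div, ← Real.sqrt_eq_rpow, ← Real.sqrt_eq_rpow, ← Real.sqrt_mul (by positivity)]
  exact Real.sqrt_le_sqrt (integral_wienerIntegral_sq_le hB φ)

theorem eLpNorm_wienerIntegral_sub_le (hB : IsTwoSidedBrownian B P) (φ ψ : OffDiagStep r) :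
    eLpNorm (fun ω => φ.wienerIntegral B ω - ψ.wienerIntegral B ω) 2 P ≤
      ENNReal.ofReal (Real.sqrt ((r : ℝ) ^ r)) *
        eLpNorm (fun x => φ.toFun x - ψ.toFun x) 2 volume := by
  obtain ⟨χ, hχ⟩ := exists_eval_sub φ ψ
  have h := eLpNorm_wienerIntegral_le hB χ
  have e1 : χ.wienerIntegral B = fun ω => φ.wienerIntegral B ω - ψ.wienerIntegral B ω :=
    funext fun ω => hχ fun _ y => B y ω
  have e2 : χ.toFun = fun x => φ.toFun x - ψ.toFun x :=
    funext fun x => by simp only [toFun_eq_eval, hχ]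
  rwa [e1, e2] at h

end Moments

end OffDiagStep

/-! ### Multiple Wiener-Itô integrals -/

section MultipleIntegral

variable {Ω : Type*} [MeasurableSpace Ω] {P : Measure Ω} {B : ℝ → Ω → ℝ} {r : ℕ}

/-- The norm bound for `r`-fold multiple Wiener-Itô integrals. -/
def isometryConst (r : ℕ) : ENNReal := ENNReal.ofReal (Real.sqrt ((r : ℝ) ^ r))

theorem tendsto_zero_const_mul_add {K : ENNReal} (hK : K ≠ ⊤) {a b : ℕ → ENNReal}
    (ha : Tendsto a atTop (𝓝 0)) (hb : Tendsto b atTop (𝓝 0)) :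
    Tendsto (fun n => K * a n + b n) atTop (𝓝 0) := by
  have := (ENNReal.Tendsto.const_mul ha (Or.inr hK)).add hb
  simpa using this

theorem eLpNorm_sub_le_add {α : Type*} [MeasurableSpace α] {μ : Measure α} {f g h : α → ℝ}
    (hf : AEStronglyMeasurable f μ) (hg : AEStronglyMeasurable g μ)
    (hh : AEStronglyMeasurable h μ) : eLpNorm (fun x => f x - h x) 2 μ ≤
      eLpNorm (fun x => f x - g x) 2 μ + eLpNorm (fun x => g x - h x) 2 μ := by
  have e : (fun x => f x - h x) = (fun x => f x - g x) + fun x => g x - h x := by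
    funext x
    simp
  rw [e]
  exact eLpNorm_add_le (hf.sub hg) (hg.sub hh) one_le_two

theorem eLpNorm_fun_sub_comm {α : Type*} [MeasurableSpace α] {μ : Measure α} (f g : α → ℝ) :
    eLpNorm (fun x => f x - g x) 2 μ = eLpNorm (fun x => g x - f x) 2 μ :=
  eLpNorm_sub_comm f g 2 μ

namespace IsMultipleWienerIntegral

variable {f g : (Fin r → ℝ) → ℝ} {Y Z : Ω → ℝ}

/-- The approximating sequence in the definition may be replaced by any other: the integrals of two
sequences with the same L² limit become close by the norm bound. -/
theorem tendsto (hB : IsTwoSidedBrownian B P) (h : IsMultipleWienerIntegral B P r f Y)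
    {ψ : ℕ → OffDiagStep r}
    (hψ : Tendsto (fun n => eLpNorm (fun x => f x - (ψ n).toFun x) 2 volume) atTop (𝓝 0)) :
    Tendsto (fun n => eLpNorm (fun ω => Y ω - (ψ n).wienerIntegral B ω) 2 P) atTop (𝓝 0) := by
  obtain ⟨hf, hY, φ, h1, h2⟩ := h
  have hlim := tendsto_zero_const_mul_add (K := isometryConst r) ENNReal.ofReal_ne_top
    (tendsto_zero_const_mul_add ENNReal.one_ne_top h1 hψ) h2
  refine tendsto_of_tendsto_of_tendsto_of_le_of_le tendsto_const_nhds hlim (fun _ => zero_le)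
    fun n => ?_
  have a1 := eLpNorm_sub_le_add hY.1 ((φ n).memLp_wienerIntegral hB).1
    ((ψ n).memLp_wienerIntegral hB).1
  have a2 := OffDiagStep.eLpNorm_wienerIntegral_sub_le hB (φ n) (ψ n)
  have a3 := eLpNorm_sub_le_add (φ n).memLp_toFun.1 hf.1 (ψ n).memLp_toFun.1
  rw [eLpNorm_fun_sub_comm (φ n).toFun f] at a3
  simp only [one_mul]
  calc _ ≤ _ := a1
    _ ≤ _ := add_le_add_right a2 _
    _ ≤ _ := add_le_add_right (mul_le_mul_right a3 _) _
    _ = _ := add_comm _ _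

theorem sub (h : IsMultipleWienerIntegral B P r f Y) (hB : IsTwoSidedBrownian B P)
    (h' : IsMultipleWienerIntegral B P r g Z) :
    IsMultipleWienerIntegral B P r (fun x => f x - g x) (fun ω => Y ω - Z ω) := by
  obtain ⟨hf, hY, φ, h1, h2⟩ := h
  obtain ⟨hg, hZ, ψ, h3, h4⟩ := h'
  choose χ hχ using fun n => OffDiagStep.exists_eval_sub (φ n) (ψ n)
  have e1 : ∀ n x, (χ n).toFun x = (φ n).toFun x - (ψ n).toFun x := fun n x => by
    simp only [OffDiagStep.toFun_eq_eval, hχ]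
  have e2 : ∀ n ω, (χ n).wienerIntegral B ω =
      (φ n).wienerIntegral B ω - (ψ n).wienerIntegral B ω := fun n ω => hχ n fun _ y => B y ω
  refine ⟨hf.sub hg, hY.sub hZ, χ, ?_, ?_⟩
  · have hlim := h1.add h3
    rw [add_zero] at hlim
    refine tendsto_of_tendsto_of_tendsto_of_le_of_le tendsto_const_nhds hlim (fun _ => zero_le)
      fun n => ?_
    have e : (fun x => f x - g x - (χ n).toFun x) =
        (fun x => f x - (φ n).toFun x) - fun x => g x - (ψ n).toFun x := by
      funext x
      simp only [e1, Pi.sub_apply]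
      ring
    simp only [e]
    exact eLpNorm_sub_le (hf.1.sub (φ n).memLp_toFun.1) (hg.1.sub (ψ n).memLp_toFun.1) one_le_two
  · have hlim := h2.add h4
    rw [add_zero] at hlim
    refine tendsto_of_tendsto_of_tendsto_of_le_of_le tendsto_const_nhds hlim (fun _ => zero_le)
      fun n => ?_
    have e : (fun ω => Y ω - Z ω - (χ n).wienerIntegral B ω) =
        (fun ω => Y ω - (φ n).wienerIntegral B ω) - fun ω => Z ω - (ψ n).wienerIntegral B ω := by
      funext ω
      simp only [e2, Pi.sub_apply]
      ring
    simp only [e]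
    exact eLpNorm_sub_le (hY.1.sub ((φ n).memLp_wienerIntegral hB).1)
      (hZ.1.sub ((ψ n).memLp_wienerIntegral hB).1) one_le_two

theorem eLpNorm_le (hB : IsTwoSidedBrownian B P) (h : IsMultipleWienerIntegral B P r f Y) :
    eLpNorm Y 2 P ≤ isometryConst r * eLpNorm f 2 volume := by
  obtain ⟨hf, hY, φ, h1, h2⟩ := h
  have hlim := (tendsto_zero_const_mul_add (K := isometryConst r) ENNReal.ofReal_ne_top
    h1 h2).const_add (isometryConst r * eLpNorm f 2 volume)
  rw [add_zero] at hlim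
  refine ge_of_tendsto' hlim fun n => ?_
  have a1 := eLpNorm_sub_le_add (h := fun _ => 0) hY.1 ((φ n).memLp_wienerIntegral hB).1
    aestronglyMeasurable_const
  have a2 := (φ n).eLpNorm_wienerIntegral_le hB
  have a3 := eLpNorm_sub_le_add (h := fun _ => 0) (φ n).memLp_toFun.1 hf.1
    aestronglyMeasurable_const
  simp only [sub_zero] at a1 a3
  rw [eLpNorm_fun_sub_comm (φ n).toFun f] at a3
  calc _ ≤ _ := a1
    _ ≤ _ := add_le_add_right (a2.trans (mul_le_mul_right a3 _)) _
    _ = _ := by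
      unfold isometryConst
      ring

theorem congr (h : IsMultipleWienerIntegral B P r f Y) (hfg : f =ᵐ[volume] g) :
    IsMultipleWienerIntegral B P r g Y := by
  obtain ⟨hf, hY, φ, h1, h2⟩ := h
  refine ⟨hf.ae_eq hfg, hY, φ, ?_, h2⟩
  refine h1.congr fun n => eLpNorm_congr_ae ?_
  filter_upwards [hfg] with x hx
  rw [hx]

end IsMultipleWienerIntegral

/-! ### Translations -/

namespace OffDiagStep

/-- The translate of an elementary integrand by `s` in every variable. -/
def shift (φ : OffDiagStep r) (s : ℝ) : OffDiagStep r where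
  N := φ.N
  pt k := s + φ.pt k
  strictMono_pt := φ.strictMono_pt.const_add s
  coeff := φ.coeff
  coeff_eq_zero := φ.coeff_eq_zero

theorem toFun_shift (φ : OffDiagStep r) (s : ℝ) (x : Fin r → ℝ) :
    (φ.shift s).toFun x = φ.toFun (x - fun _ => s) := by
  simp only [toFun_eq_eval]
  unfold eval shift
  simp only [Pi.sub_apply, sub_le_iff_le_add']

theorem map_wienerIntegral_shift (hB : IsTwoSidedBrownian B P) {ι : Type*} [Fintype ι]
    (φ : ι → OffDiagStep r) (s : ℝ) :
    P.map (fun ω z => ((φ z).shift s).wienerIntegral B ω) =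
      P.map (fun ω z => (φ z).wienerIntegral B ω) := by
  -- All the integrals are one fixed polynomial map `Ψ` of the joint vector of Brownian increments,
  -- whose law is invariant under time shifts.
  set Ψ : ((Σ z : ι, Fin (φ z).N) → ℝ) → ι → ℝ := fun v z =>
    ∑ i : Fin r → Fin (φ z).N, (φ z).coeff i * ∏ j, v ⟨z, i j⟩ with hΨ
  have hΨm : Measurable Ψ := by
    refine measurable_pi_lambda _ fun z => ?_
    simp only [hΨ]
    fun_prop
  have h1 := hB.map_increments_eq (ι := Σ z : ι, Fin (φ z).N)
    (fun k => (φ k.1).pt k.2.succ) (fun k => (φ k.1).pt k.2.castSucc) s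
  have h2 := congrArg (fun μ => μ.map Ψ) h1
  rw [AEMeasurable.map_map_of_aemeasurable hΨm.aemeasurable
      (hB.hasGaussianLaw_increments (fun k : Σ z : ι, Fin (φ z).N => s + (φ k.1).pt k.2.succ)
        fun k => s + (φ k.1).pt k.2.castSucc).aemeasurable,
    AEMeasurable.map_map_of_aemeasurable hΨm.aemeasurable
      (hB.hasGaussianLaw_increments (fun k : Σ z : ι, Fin (φ z).N => (φ k.1).pt k.2.succ)
        fun k => (φ k.1).pt k.2.castSucc).aemeasurable] at h2
  exact h2

end OffDiagStep

theorem tendstoInMeasure_pi {ι : Type*} [Fintype ι] {X : ℕ → Ω → ι → ℝ} {V : Ω → ι → ℝ}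
    (h : ∀ i, TendstoInMeasure P (fun n ω => X n ω i) atTop (fun ω => V ω i)) :
    TendstoInMeasure P X atTop V := by
  intro ε hε
  have hlim : Tendsto (fun n => ∑ i, P {ω | ε ≤ edist (X n ω i) (V ω i)}) atTop
      (𝓝 (∑ _i : ι, 0)) := tendsto_finsetSum _ fun i _ => h i ε hε
  rw [Finset.sum_const_zero] at hlim
  refine tendsto_of_tendsto_of_tendsto_of_le_of_le tendsto_const_nhds hlim (fun _ => zero_le)
    fun n => ?_
  refine (measure_mono fun ω hω => ?_).trans (measure_biUnion_finset_le Finset.univ _)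
  have hω' : ε ≤ edist (X n ω) (V ω) := hω
  rw [edist_pi_def, Finset.le_sup_iff hε] at hω'
  obtain ⟨i, hi, hi'⟩ := hω'
  exact Set.mem_biUnion hi hi'

/-- A process whose increments over `[s, s + t]` are multiple integrals of translates by `s` of a
fixed kernel has stationary increments. -/
theorem hasStationaryIncrements_of_kernel (hB : IsTwoSidedBrownian B P) {W : ℝ → Ω → ℝ}
    {f : ℝ → (Fin r → ℝ) → ℝ}
    (hW : ∀ s t, IsMultipleWienerIntegral B P r (fun x => f t (x - fun _ => s))
      (fun ω => W (s + t) ω - W s ω)) :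
    HasStationaryIncrements W P := by
  have := hB.isGaussianProcess.isProbabilityMeasure
  have hφ : ∀ t, ∃ φ : ℕ → OffDiagStep r,
      Tendsto (fun n => eLpNorm (fun x => f t x - (φ n).toFun x) 2 volume) atTop (𝓝 0) := fun t => by
    obtain ⟨-, -, φ, h, -⟩ := hW 0 t
    refine ⟨φ, h.congr fun n => ?_⟩
    have e : ∀ x : Fin r → ℝ, (x - fun _ => (0 : ℝ)) = x := fun x => by ext; simp
    simp only [e]
  choose φ hφ using hφ
  have hf : ∀ t, AEStronglyMeasurable (f t) volume := fun t => by
    have h := (hW 0 t).1.1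
    have e : ∀ x : Fin r → ℝ, (x - fun _ => (0 : ℝ)) = x := fun x => by ext; simp
    simpa only [e] using h
  have hconv : ∀ s t, Tendsto (fun n => eLpNorm (fun ω => (W (s + t) ω - W s ω) -
      ((φ t n).shift s).wienerIntegral B ω) 2 P) atTop (𝓝 0) := fun s t => by
    refine (hW s t).tendsto hB ((hφ t).congr fun n => ?_)
    have hm : MeasurePreserving (fun x : Fin r → ℝ => x - fun _ => s) volume volume :=
      measurePreserving_sub_right volume fun _ => s
    simp only [OffDiagStep.toFun_shift]
    exact (eLpNorm_comp_measurePreserving (g := fun x => f t x - (φ t n).toFun x)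
      ((hf t).sub (φ t n).memLp_toFun.1) hm).symm
  have hmeas : ∀ n s t, AEMeasurable ((((φ t n).shift s)).wienerIntegral B) P := fun n s t =>
    (((φ t n).shift s).memLp_wienerIntegral hB).1.aemeasurable
  intro s I
  -- The unshifted integrals have the same laws as the shifted ones, so a single sequence,
  -- independent of `s`, converges in distribution to the increments from every `s`; uniqueness of
  -- the limit law concludes.
  have key : ∀ s, TendstoInDistribution
      (fun n ω (z : I) => (φ ((z : ℚ) : ℝ) n).wienerIntegral B ω) atTop
      (fun ω (z : I) => W (s + (z : ℚ)) ω - W s ω) (fun _ => P) P := fun s => by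
    have h1 : TendstoInMeasure P
        (fun n ω (z : I) => ((φ ((z : ℚ) : ℝ) n).shift s).wienerIntegral B ω) atTop
        (fun ω (z : I) => W (s + (z : ℚ)) ω - W s ω) := by
      refine tendstoInMeasure_pi fun z => ?_
      refine tendstoInMeasure_of_tendsto_eLpNorm two_ne_zero
        (fun n => (((φ _ n).shift s).memLp_wienerIntegral hB).1) (hW s _).2.1.1 ?_
      refine (hconv s (z : ℚ)).congr fun n => ?_
      exact eLpNorm_fun_sub_comm _ _
    have h2 := h1.tendstoInDistribution fun n => aemeasurable_pi_lambda _ fun z => hmeas n s _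
    have hm0 : ∀ n, AEMeasurable
        (fun ω (z : I) => (φ ((z : ℚ) : ℝ) n).wienerIntegral B ω) P := fun n =>
      aemeasurable_pi_lambda _ fun z => ((φ _ n).memLp_wienerIntegral hB).1.aemeasurable
    refine ⟨hm0, h2.aemeasurable_limit, h2.tendsto.congr fun n => Subtype.ext ?_⟩
    exact OffDiagStep.map_wienerIntegral_shift hB (fun z : I => φ ((z : ℚ) : ℝ) n) s
  exact tendstoInDistribution_unique _ (key s) (key 0)

end MultipleIntegral

/-! ### The kernel of the Hermite process -/

section Kernel

variable {r : ℕ}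

/-- The exponent in the kernel of the Hermite process. -/
def hermiteExponent (r : ℕ) (H : ℝ) : ℝ := 1 / 2 + (1 - H) / (r : ℝ)

theorem hermiteExponent_pos {H : ℝ} (hH : H < 1) : 0 < hermiteExponent r H := by
  have : 0 ≤ (1 - H) / (r : ℝ) := div_nonneg (by linarith) (Nat.cast_nonneg r)
  unfold hermiteExponent
  linarith

theorem hermiteExponent_lt_one {H : ℝ} (hr : 1 ≤ r) (hH : 1 / 2 < H) (hH' : H < 1) :
    hermiteExponent r H < 1 := by
  have h1 : (1 : ℝ) ≤ r := by exact_mod_cast hr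
  have : (1 - H) / (r : ℝ) ≤ 1 - H := div_le_self (by linarith) h1
  unfold hermiteExponent
  linarith

/-- The integrand defining the kernel of the Hermite process. -/
def hermiteIntegrand (r : ℕ) (H : ℝ) (x : Fin r → ℝ) (u : ℝ) : ℝ :=
  ∏ j, (if x j < u then (u - x j) ^ (-hermiteExponent r H) else 0)

theorem hermiteKernelCore_eq (H t : ℝ) (x : Fin r → ℝ) :
    hermiteKernelCore r H t x = ∫ u in (0 : ℝ)..t, hermiteIntegrand r H x u := rfl

theorem measurable_hermiteIntegrand (H : ℝ) (x : Fin r → ℝ) :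
    Measurable (hermiteIntegrand r H x) := by
  unfold hermiteIntegrand
  refine Finset.measurable_fun_prod _ fun j _ => ?_
  exact Measurable.ite measurableSet_Ioi (by fun_prop) measurable_const

/-- The integrand is supported to the right of the largest coordinate. With distinct coordinates
only that coordinate's factor is singular there, with exponent above `-1`; the other factors are
bounded by their values at `x m`. -/
theorem intervalIntegrable_hermiteIntegrand {H : ℝ} (hr : 1 ≤ r) (hH : 1 / 2 < H) (hH' : H < 1)
    {x : Fin r → ℝ} (hx : Function.Injective x) (a b : ℝ) :
    IntervalIntegrable (hermiteIntegrand r H x) volume a b := by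
  have : Nonempty (Fin r) := ⟨⟨0, hr⟩⟩
  obtain ⟨m, hm⟩ := Finite.exists_max x
  set α := hermiteExponent r H with hα
  have hα0 : 0 < α := hermiteExponent_pos hH'
  have hα1 : α < 1 := hermiteExponent_lt_one hr hH hH'
  set K : ℝ := ∏ j ∈ Finset.univ.erase m, (x m - x j) ^ (-α) with hK
  have hint : IntervalIntegrable (fun u => K * (u - x m) ^ (-α)) volume a b := by
    refine IntervalIntegrable.const_mul ?_ K
    have h := intervalIntegral.intervalIntegrable_rpow' (a := a - x m) (b := b - x m)
      (show -1 < -α by linarith)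
    simpa using h.comp_sub_right (x m)
  refine hint.mono_fun (measurable_hermiteIntegrand H x).aestronglyMeasurable
    (Eventually.of_forall fun u => ?_)
  simp only
  rcases le_or_gt u (x m) with hu | hu
  · have : hermiteIntegrand r H x u = 0 :=
      Finset.prod_eq_zero (Finset.mem_univ m) (if_neg (not_lt.2 hu))
    rw [this, norm_zero]
    exact norm_nonneg _
  · have e : hermiteIntegrand r H x u =
        (∏ j ∈ Finset.univ.erase m, (u - x j) ^ (-α)) * (u - x m) ^ (-α) := by
      unfold hermiteIntegrand
      rw [Finset.prod_erase_mul _ _ (Finset.mem_univ m)]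
      exact Finset.prod_congr rfl fun j _ => if_pos ((hm j).trans_lt hu)
    rw [e, norm_mul, norm_mul]
    refine mul_le_mul_of_nonneg_right ?_ (norm_nonneg _)
    rw [hK, norm_prod, norm_prod]
    refine Finset.prod_le_prod (fun _ _ => norm_nonneg _) fun j hj => ?_
    have hlt : x j < x m := lt_of_le_of_ne (hm j) fun h => (Finset.ne_of_mem_erase hj) (hx h)
    rw [Real.norm_of_nonneg (Real.rpow_nonneg (by linarith) _),
      Real.norm_of_nonneg (Real.rpow_nonneg (by linarith) _)]
    exact Real.rpow_le_rpow_of_nonpos (by linarith) (by linarith) (by linarith)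

/-- Each diagonal `x j = x j'` is a proper linear subspace, hence null. -/
theorem ae_injective : ∀ᵐ x : Fin r → ℝ, Function.Injective x := by
  have h : ∀ j j' : Fin r, j ≠ j' → ∀ᵐ x : Fin r → ℝ, x j ≠ x j' := by
    intro j j' hne
    set L : (Fin r → ℝ) →ₗ[ℝ] ℝ := LinearMap.proj (R := ℝ) (φ := fun _ : Fin r => ℝ) j - LinearMap.proj (R := ℝ) (φ := fun _ : Fin r => ℝ) j' with hL
    have hker : LinearMap.ker L ≠ ⊤ := by
      intro htop
      have h1 : Pi.single j (1 : ℝ) ∈ LinearMap.ker L := htop ▸ Submodule.mem_top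
      simp [hL, hne.symm] at h1
    have h0 := Measure.addHaar_submodule (volume : Measure (Fin r → ℝ)) (LinearMap.ker L) hker
    rw [ae_iff]
    convert h0 using 2
    ext x
    simp [hL, sub_eq_zero]
  have h' : ∀ᵐ x : Fin r → ℝ, ∀ j j' : Fin r, j ≠ j' → x j ≠ x j' := by
    simp only [ae_all_iff]
    exact fun j j' hne => h j j' hne
  filter_upwards [h'] with x hx j j' hjj
  by_contra hne
  exact hx j j' hne hjj

theorem hermiteIntegrand_sub_const (H : ℝ) (x : Fin r → ℝ) (s u : ℝ) :
    hermiteIntegrand r H (x - fun _ => s) u = hermiteIntegrand r H x (u + s) := by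
  unfold hermiteIntegrand
  refine Finset.prod_congr rfl fun j _ => ?_
  simp only [Pi.sub_apply, sub_lt_iff_lt_add]
  rw [show u - (x j - s) = u + s - x j by ring]

theorem hermiteKernelCore_sub_const {H : ℝ} (hr : 1 ≤ r) (hH : 1 / 2 < H) (hH' : H < 1)
    {x : Fin r → ℝ} (hx : Function.Injective x) (s t : ℝ) :
    hermiteKernelCore r H t (x - fun _ => s) =
      hermiteKernelCore r H (s + t) x - hermiteKernelCore r H s x := by
  simp only [hermiteKernelCore_eq, hermiteIntegrand_sub_const]
  rw [intervalIntegral.integral_comp_add_right (fun u => hermiteIntegrand r H x u),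
    intervalIntegral.integral_interval_sub_left
      (intervalIntegrable_hermiteIntegrand hr hH hH' hx _ _)
      (intervalIntegrable_hermiteIntegrand hr hH hH' hx _ _), zero_add, add_comm t s]

/-- The substitution contributes `t` and each of the `r` factors contributes `t` to the power
`-hermiteExponent r H`. -/
theorem hermiteKernelCore_smul {H t : ℝ} (ht : 0 < t) (x : Fin r → ℝ) :
    hermiteKernelCore r H t (t • x) =
      t ^ (1 - hermiteExponent r H * r) * hermiteKernelCore r H 1 x := by
  have h1 : ∀ v, hermiteIntegrand r H (t • x) (t * v) =
      t ^ (-hermiteExponent r H * r) * hermiteIntegrand r H x v := by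
    intro v
    unfold hermiteIntegrand
    have e : (t : ℝ) ^ (-hermiteExponent r H * r) =
        ∏ _j : Fin r, t ^ (-hermiteExponent r H) := by
      rw [Finset.prod_const, Finset.card_univ, Fintype.card_fin, Real.rpow_mul ht.le,
        Real.rpow_natCast]
    rw [e, ← Finset.prod_mul_distrib]
    refine Finset.prod_congr rfl fun j _ => ?_
    simp only [Pi.smul_apply, smul_eq_mul, mul_lt_mul_iff_right₀ ht]
    split_ifs with h
    · rw [← mul_sub, Real.mul_rpow ht.le (by linarith)]
    · rw [mul_zero]
  have h2 := intervalIntegral.smul_integral_comp_mul_left (a := 0) (b := 1)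
    (fun u => hermiteIntegrand r H (t • x) u) t
  rw [mul_zero, mul_one] at h2
  rw [hermiteKernelCore_eq, ← h2, hermiteKernelCore_eq]
  simp_rw [h1]
  rw [intervalIntegral.integral_const_mul, smul_eq_mul, ← mul_assoc]
  congr 1
  rw [sub_eq_add_neg, Real.rpow_add ht, Real.rpow_one, neg_mul]

theorem hermiteKernel_sub_const {H : ℝ} (hr : 1 ≤ r) (hH : 1 / 2 < H) (hH' : H < 1)
    {x : Fin r → ℝ} (hx : Function.Injective x) (s t : ℝ) :
    hermiteKernel r H t (x - fun _ => s) =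
      hermiteKernel r H (s + t) x - hermiteKernel r H s x := by
  simp only [hermiteKernel, hermiteKernelCore_sub_const hr hH hH' hx, mul_sub]

theorem hermiteKernel_smul {H t : ℝ} (ht : 0 < t) (x : Fin r → ℝ) :
    hermiteKernel r H t (t • x) =
      t ^ (1 - hermiteExponent r H * r) * hermiteKernel r H 1 x := by
  simp only [hermiteKernel, hermiteKernelCore_smul ht]
  ring

/-- Dilating ℝ^r adds r/2 to the scaling exponent of the kernel, and 1 - r(1/2 + (1 - H)/r) + r/2 =
H. -/
theorem eLpNorm_hermiteKernel {H t : ℝ} (hr : 1 ≤ r) (ht : 0 < t) :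
    eLpNorm (hermiteKernel r H t) 2 volume =
      ENNReal.ofReal (t ^ H) * eLpNorm (hermiteKernel r H 1) 2 volume := by
  have hemb : MeasurableEmbedding (fun x : Fin r → ℝ => t • x) :=
    (Homeomorph.smulOfNeZero t ht.ne').measurableEmbedding
  have h1 := hemb.eLpNorm_map_measure (μ := volume) (p := 2) (g := hermiteKernel r H t)
  have hpow : 0 < t ^ r := by positivity
  rw [Measure.map_addHaar_smul volume ht.ne', Module.finrank_fin_fun, abs_of_pos (by positivity),
    eLpNorm_smul_measure_of_ne_top ENNReal.ofNat_ne_top] at h1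
  have h2 : (hermiteKernel r H t) ∘ (fun x : Fin r → ℝ => t • x) =
      (t ^ (1 - hermiteExponent r H * r)) • hermiteKernel r H 1 := by
    funext x
    exact hermiteKernel_smul ht x
  rw [h2, eLpNorm_const_smul, smul_eq_mul, Real.enorm_of_nonneg (Real.rpow_nonneg ht.le _)] at h1
  have e3 : ENNReal.ofReal (t ^ r)⁻¹ ^ (1 / (2 : ENNReal)).toReal =
      ENNReal.ofReal (t ^ (-(r : ℝ) / 2)) := by
    rw [ENNReal.ofReal_rpow_of_nonneg (by positivity) (by positivity), ← Real.rpow_natCast,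
      ← Real.rpow_neg ht.le, ← Real.rpow_mul ht.le]
    norm_num
    ring_nf
  rw [e3] at h1
  have hr0 : (r : ℝ) ≠ 0 := by
    have : (0 : ℝ) < r := by exact_mod_cast hr
    exact this.ne'
  calc eLpNorm (hermiteKernel r H t) 2 volume
      = ENNReal.ofReal (t ^ ((r : ℝ) / 2)) * (ENNReal.ofReal (t ^ (-(r : ℝ) / 2)) *
          eLpNorm (hermiteKernel r H t) 2 volume) := by
        rw [← mul_assoc, ← ENNReal.ofReal_mul (by positivity), ← Real.rpow_add ht]
        rw [show (r : ℝ) / 2 + -(r : ℝ) / 2 = 0 by ring, Real.rpow_zero, ENNReal.ofReal_one, one_mul]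
    _ = _ := by
        rw [h1, ← mul_assoc, ← ENNReal.ofReal_mul (by positivity), ← Real.rpow_add ht]
        congr 3
        unfold hermiteExponent
        field_simp
        ring

end Kernel

/-! ### Regularity of Hermite processes -/

section Hermite

variable {Ω : Type*} [MeasurableSpace Ω] {P : Measure Ω} {B W : ℝ → Ω → ℝ} {r : ℕ} {H : ℝ}

theorem isMultipleWienerIntegral_increment (hB : IsTwoSidedBrownian B P) (hr : 1 ≤ r)
    (hH : 1 / 2 < H) (hH' : H < 1)
    (hW : ∀ t, IsMultipleWienerIntegral B P r (hermiteKernel r H t) (W t)) (s t : ℝ) :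
    IsMultipleWienerIntegral B P r (fun x => hermiteKernel r H t (x - fun _ => s))
      (fun ω => W (s + t) ω - W s ω) := by
  refine ((hW (s + t)).sub hB (hW s)).congr ?_
  filter_upwards [ae_injective] with x hx
  exact (hermiteKernel_sub_const hr hH hH' hx s t).symm

/-- An increment is the integral of a translated kernel, whose L² norm is that of the kernel at time
t - s. Second moments suffice since H > 1/2 makes the exponent 2H exceed 1. -/
theorem exists_hasMomentBound_hermite (hB : IsTwoSidedBrownian B P) (hr : 1 ≤ r)
    (hH : 1 / 2 < H) (hH' : H < 1)
    (hW : ∀ t, IsMultipleWienerIntegral B P r (hermiteKernel r H t) (W t)) :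
    ∃ C, 0 ≤ C ∧ HasMomentBound W P 2 (2 * H) C := by
  set A := isometryConst r * eLpNorm (hermiteKernel r H 1) 2 volume with hA
  have hA' : A ≠ ⊤ := ENNReal.mul_ne_top ENNReal.ofReal_ne_top (hW 1).1.2.ne
  refine ⟨A.toReal ^ 2, by positivity, fun s t hst => ?_⟩
  have hnorm : eLpNorm (fun ω => W t ω - W s ω) 2 P ≤ ENNReal.ofReal ((t - s) ^ H) * A := by
    rcases hst.lt_or_eq with hlt | rfl
    · have h1 := (isMultipleWienerIntegral_increment hB hr hH hH' hW s (t - s)).eLpNorm_le hB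
      rw [add_sub_cancel] at h1
      have h2 := eLpNorm_comp_measurePreserving (p := 2) (hW (t - s)).1.1
        (measurePreserving_sub_right (volume : Measure (Fin r → ℝ)) fun _ => s)
      rw [eLpNorm_hermiteKernel hr (sub_pos.2 hlt)] at h2
      refine h1.trans_eq ?_
      rw [hA, mul_left_comm, ← h2]
      rfl
    · simp
  have hsq := eLpNorm_nnreal_pow_eq_lintegral (μ := P) (f := fun ω => W t ω - W s ω) (p := 2)
    two_ne_zero
  have e2 : ((2 : NNReal) : ℝ) = ((2 : ℕ) : ℝ) := by norm_num
  simp only [e2, ENNReal.rpow_natCast] at hsq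
  rw [← hsq]
  refine (pow_le_pow_left₀ zero_le hnorm 2).trans_eq ?_
  have hts : 0 ≤ t - s := sub_nonneg.2 hst
  rw [mul_pow, ← ENNReal.ofReal_pow (Real.rpow_nonneg hts _), ← Real.rpow_natCast,
    ← Real.rpow_mul hts, ENNReal.ofReal_mul (by positivity), ENNReal.ofReal_pow ENNReal.toReal_nonneg,
    ENNReal.ofReal_toReal hA', mul_comm, mul_comm H]
  norm_num

theorem ae_regularSlopes_hermite [IsProbabilityMeasure P] {a b : ℝ} (ha : 0 < a) (hb : 0 < b)
    (hr : 1 ≤ r) (hH : 1 / 2 < H) (hH' : H < 1) (hW : IsHermiteProcess r H W P) :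
    ∀ᵐ ω ∂P, RegularSlopes (driftedPath a b W ω) := by
  obtain ⟨⟨B, hB, hWB⟩, hcont⟩ := hW
  obtain ⟨C, hC, hmom⟩ := exists_hasMomentBound_hermite hB hr hH hH' hWB
  exact ae_regularSlopes ha hb (fun t => (hWB t).2.1.1.aemeasurable) hcont
    (hasStationaryIncrements_of_kernel hB (isMultipleWienerIntegral_increment hB hr hH hH' hWB))
    le_rfl (by linarith) hC hmom

theorem ae_regularSlopes_brownian [IsProbabilityMeasure P] {a b : ℝ} (ha : 0 < a) (hb : 0 < b)
    (hW : IsTwoSidedBrownian W P) : ∀ᵐ ω ∂P, RegularSlopes (driftedPath a b W ω) := by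
  obtain ⟨C, hC, hmom⟩ := hW.exists_hasMomentBound
  exact ae_regularSlopes ha hb (fun t => (hW.memLp t).1.aemeasurable) hW.continuous_paths
    hW.hasStationaryIncrements (by norm_num) (by norm_num) hC hmom

end Hermite

end MonotoneTrend

end

theorem mainTheorem10 {Ω : Type*} [MeasurableSpace Ω] (P : Measure Ω) [IsProbabilityMeasure P]
    (a b : ℝ) (ha : 0 < a) (hb : 0 < b) (W : ℝ → Ω → ℝ)
    (hW : MonotoneTrend.IsTwoSidedBrownian W P ∨
      ∃ (r : ℕ) (H : ℝ), 1 ≤ r ∧ 1 / 2 < H ∧ H < 1 ∧ MonotoneTrend.IsHermiteProcess r H W P) :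
    ∀ᵐ ω ∂P,
      let G : ℝ → ℝ := MonotoneTrend.driftedPath a b W ω
      let S : ℝ → ℝ := MonotoneTrend.slopeGCM G
      let Sc : ℝ → ℝ → ℝ := MonotoneTrend.slopeGCMConstrained G
      let L : ℝ → ℝ := MonotoneTrend.LInfty a G
      let T : ℝ → ℝ := MonotoneTrend.TInfty a G
      (∀ h : ℝ,
        IntegrableOn (fun z => S z ^ 2 - Sc h z ^ 2) (MonotoneTrend.diffSet G h) ∧
        IntegrableOn (fun z => S z - Sc h z) (MonotoneTrend.diffSet G h) ∧
        IntegrableOn (fun z => (S z - Sc h z) ^ 2) (MonotoneTrend.diffSet G h)) ∧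
      (L (S 0) = 0 ∧ T (S 0) = 0) ∧
      (StrictAntiOn L (Set.Iic (S 0)) ∧ StrictMonoOn L (Set.Ioi (S 0))) ∧
      (StrictAntiOn T (Set.Iic (S 0)) ∧ StrictMonoOn T (Set.Ioi (S 0))) := by
  have hreg : ∀ᵐ ω ∂P, MonotoneTrend.RegularSlopes (MonotoneTrend.driftedPath a b W ω) := by
    rcases hW with hW | ⟨r, H, hr, hH, hH', hW⟩
    · exact MonotoneTrend.ae_regularSlopes_brownian ha hb hW
    · exact MonotoneTrend.ae_regularSlopes_hermite ha hb hr hH hH' hW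
  filter_upwards [hreg] with ω hω
  exact hω.conclusion ha
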